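/- Work in hyperbolic 3-space $\mathbb{H}^3$. A polyhedron is an intersection of finitely many closed half-spaces of $\mathbb{H}^3$ with nonempty interior and finite volume; its faces are its 2-dimensional faces, two distinct faces are adjacent if they share an edge, and a face is a $k$-gon if it has exactly $k$ edges. A polyhedron is ideal if all its vertices lie on $\partial\mathbb{H}^3$, and it is $\pi/3$-equiangular if the dihedral angle at every edge equals $\pi/3$. For every integer $n\ge 1$ there is an ideal $\pi/3$-equiangular polyhedron $P_n$ in $\mathbb{H}^3$ with exactly $(n^2+n+6)/2$ faces and exactly $n^2+n+2$ vertices, all of them ideal, and with the following combinatorial structure. (1) There is an ideal vertex $v_0$ that is shared by exactly three faces $A_1,A_2,A_3$; these are pairwise adjacent, and each of them is an $(n+2)$-gon. (2) With indices mod 3, for each $i$ there is exactly one face $B_i$, other than $A_{i+2}$, that is adjacent to both $A_i$ and $A_{i+1}$. If $n\ge 2$, then $B_1,B_2,B_3$ are three distinct quadrilaterals; if $n=1$, then $B_1=B_2=B_3$ is a triangle (so $P_1$ is a tetrahedron). (3) Every face other than the $A_i$ and $B_i$ that is adjacent to at least one of $A_1,A_2,A_3$ is adjacent to exactly one of them and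 is a pentagon. If $n\ge 2$, there are exactly $3(n-2)$ such faces. (4) Every face other than the $A_i$ that is adjacent to none of $A_1,A_2,A_3$ is a hexagon. If $n\ge 2$, there are exactly $(n-3)(n-2)/2$ such faces. Consequently there are infinitely many $\pi/3$-equiangular polyhedra in $\mathbb{H}^3$, even up to isometry. -/

import Mathlib

namespace Hyp

open MeasureTheory

noncomputable section

/-- The Lorentzian inner product on `ℝ^{1,3}`. -/
def lor (x y : Fin 4 → ℝ) : ℝ :=
  -(x 0 * y 0) + x 1 * y 1 + x 2 * y 2 + x 3 * y 3

/-- Hyperbolic 3-space: the upper sheet of the hyperboloid `⟨x, x⟩ = -1` in `ℝ^{1,3}`. -/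
def H3 : Type := {x : Fin 4 → ℝ // lor x x = -1 ∧ 0 < x 0}

/-- The topology of `H3`: the one induced from `ℝ⁴` (it is also the one of the hyperbolic metric). -/
instance : TopologicalSpace H3 :=
  inferInstanceAs (TopologicalSpace {x : Fin 4 → ℝ // lor x x = -1 ∧ 0 < x 0})

/-- The hyperbolic distance: `cosh d(x, y) = -⟨x, y⟩`. -/
def hdist (x y : H3) : ℝ := Real.arcosh (-lor x.1 y.1)

/-- Two subsets of `H3` are congruent if an isometry of `H3` maps one onto the other. -/
def Congruent (P Q : Set H3) : Prop :=
  ∃ f : H3 ≃ H3, (∀ x y, hdist (f x) (f y) = hdist x y) ∧ f '' P = Q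

/-- Congruence as an equivalence relation; its classes are the isometry classes of subsets. -/
def congruence : Setoid (Set H3) where
  r := Congruent
  iseqv :=
    { refl := fun P => ⟨Equiv.refl H3, fun _ _ => rfl, by simp⟩
      symm := by
        rintro P Q ⟨f, hf, rfl⟩
        refine ⟨f.symm, fun x y => ?_, by simp⟩
        simpa using (hf (f.symm x) (f.symm y)).symm
      trans := by
        rintro P Q R ⟨f, hf, rfl⟩ ⟨g, hg, rfl⟩
        refine ⟨f.trans g, fun x y => ?_, ?_⟩
        · simp [hf, hg]
        · simp [Set.image_image] }

/-- Radial projection of the hyperboloid onto the open unit ball of `ℝ³` (the projective, or Klein,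
model). The boundary at infinity of `H3` is the unit sphere of this `ℝ³`. -/
def klein (x : H3) : EuclideanSpace ℝ (Fin 3) :=
  WithLp.toLp 2 fun i => x.1 i.succ / x.1 0

/-- Hyperbolic volume, whose density in the projective model is `(1 - |y|²)⁻²`. -/
def hvol (P : Set H3) : ENNReal :=
  ∫⁻ y in klein '' P, ENNReal.ofReal (1 / (1 - ‖y‖ ^ 2) ^ 2)

/-- The closed half-spaces of `H3` are the sets `{x | ⟨x, e⟩ ≤ 0}` with `⟨e, e⟩ = 1`; the vector `e`
is the unit normal of the bounding plane `{x | ⟨x, e⟩ = 0}` pointing out of the half-space.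
A (convex) polyhedron is an intersection of finitely many closed half-spaces which has interior
points and finite volume. -/
def IsPolyhedron (P : Set H3) : Prop :=
  (∃ S : Set (Fin 4 → ℝ), S.Finite ∧ (∀ e ∈ S, lor e e = 1) ∧
    P = {x : H3 | ∀ e ∈ S, lor x.1 e ≤ 0}) ∧
  (interior P).Nonempty ∧ hvol P < ⊤

/-- `e` is the outer unit normal of a plane that supports `P` exactly along `F`. -/
def IsOuterNormal (P F : Set H3) (e : Fin 4 → ℝ) : Prop :=
  lor e e = 1 ∧ (∀ x ∈ P, lor x.1 e ≤ 0) ∧ F = {x | x ∈ P ∧ lor x.1 e = 0}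

/-- `F` is a `k`-dimensional face of `P`: the part of `P` on a supporting plane, of dimension `k`.
(A convex subset of `H3` has dimension `k` iff its linear span in `ℝ⁴` has dimension `k + 1`.) -/
def IsFace (P : Set H3) (k : ℕ) (F : Set H3) : Prop :=
  (∃ e, IsOuterNormal P F e) ∧
  Module.finrank ℝ (Submodule.span ℝ ((fun x : H3 => x.1) '' F)) = k + 1

/-- The 2-dimensional faces. -/
def faces (P : Set H3) : Set (Set H3) := {F | IsFace P 2 F}

/-- Two distinct 2-dimensional faces are adjacent if they share an edge. -/
def Adjacent (P F G : Set H3) : Prop :=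
  F ∈ faces P ∧ G ∈ faces P ∧ F ≠ G ∧ IsFace P 1 (F ∩ G)

/-- The 2-dimensional face `F` of `P` is a `k`-gon, i.e. it has exactly `k` edges. -/
def IsGon (P : Set H3) (k : ℕ) (F : Set H3) : Prop :=
  F ∈ faces P ∧ {E | IsFace P 1 E ∧ E ⊆ F}.encard = k

/-- The points at infinity of `P`: the points of the unit sphere in the closure of `P` in the
closed ball. -/
def pointsAtInfinity (P : Set H3) : Set (EuclideanSpace ℝ (Fin 3)) :=
  Metric.sphere 0 1 ∩ closure (klein '' P)

/-- The ideal vertices of a polyhedron. Since polyhedra have finite volume, these are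
all its points at infinity. -/
def idealVertices (P : Set H3) : Set (EuclideanSpace ℝ (Fin 3)) := pointsAtInfinity P

/-- A polyhedron is ideal if it has no vertices in `H3`. -/
def IsIdealPolyhedron (P : Set H3) : Prop :=
  IsPolyhedron P ∧ ∀ x : H3, ¬ IsFace P 0 {x}

/-- A polyhedron all of whose dihedral angles equal `θ`. The dihedral angle at the common edge of
two adjacent faces is `π` minus the angle between their outer unit normals; these normals are
tangent to `H3` along the edge, where `lor` is the Riemannian inner product. -/
def IsEquiangular (θ : ℝ) (P : Set H3) : Prop :=
  IsPolyhedron P ∧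
  ∀ F G, Adjacent P F G → ∀ e f, IsOuterNormal P F e → IsOuterNormal P G f →
    Real.pi - Real.arccos (lor e f) = θ

/-- The combinatorial structure of `P_n`, `n ≥ 1`. Indices in `Fin 3` are read cyclically. -/
def HasStructure (n : ℕ) (P : Set H3) : Prop :=
  ∃ v₀ ∈ idealVertices P, ∃ A B : Fin 3 → Set H3,
    -- exactly three faces `A i` share `v₀`; they are pairwise adjacent `(n+2)`-gons
    Function.Injective A ∧
    {F | F ∈ faces P ∧ v₀ ∈ pointsAtInfinity F} = Set.range A ∧
    (∀ i j, i ≠ j → Adjacent P (A i) (A j)) ∧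
    (∀ i, IsGon P (n + 2) (A i)) ∧
    -- `B i` is the face adjacent to `A i` and `A (i+1)` other than `A (i+2)`
    (∀ i, {F | Adjacent P F (A i) ∧ Adjacent P F (A (i + 1)) ∧ F ≠ A (i + 2)} = {B i}) ∧
    -- for `n = 1` the `B i` are one triangle, for `n ≥ 2` three quadrilaterals
    (n = 1 → ∀ i, B i = B 0 ∧ IsGon P 3 (B i)) ∧
    (2 ≤ n → Function.Injective B ∧ ∀ i, IsGon P 4 (B i)) ∧
    -- the other faces adjacent to some `A i` are adjacent to just one of them and are pentagons
    (∀ F ∈ faces P, F ∉ Set.range A → F ∉ Set.range B → (∃ i, Adjacent P F (A i)) →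
      (∃! i, Adjacent P F (A i)) ∧ IsGon P 5 F) ∧
    -- the remaining faces are hexagons
    (∀ F ∈ faces P, F ∉ Set.range A → (∀ i, ¬ Adjacent P F (A i)) → IsGon P 6 F) ∧
    -- the numbers of these pentagons and hexagons
    (2 ≤ n →
      {F | F ∈ faces P ∧ F ∉ Set.range A ∧ F ∉ Set.range B ∧
        ∃ i, Adjacent P F (A i)}.encard = (3 * (n - 2) : ℕ) ∧
      {F | F ∈ faces P ∧ F ∉ Set.range A ∧
        ∀ i, ¬ Adjacent P F (A i)}.encard = ((n - 3) * (n - 2) / 2 : ℕ))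

end

end Hyp

namespace Hyp

open MeasureTheory

noncomputable section

/-! ### The Lorentzian inner product -/

/-! Use the upper half-space model with `v₀` at infinity. Three vertical planes over the sides of an
equilateral triangle meet pairwise at angle `π / 3`. Over this triangle put equal hemispheres
centred at the points of a triangular lattice `Tri m`, where `m = n - 1`. The spacing is `√3` times
the radius, so that neighbouring hemispheres meet at `π / 3`; the outermost rows lie half a radius
from the sides, so that they meet the vertical planes at `π / 3` as well. Any other two walls do not
cross inside hyperbolic space. The boundary circles pass through the vertices of the honeycomb dual
to the lattice, and these together with infinity are the ideal vertices. The face on a hemisphere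
lies over a honeycomb cell clipped by the triangle. A centre in the row next to a side has that side
in place of two neighbours, so its face has 6 minus (number of such sides) edges: hexagons inside,
pentagons along the sides, quadrilaterals in the corners, and a triangle when `m = 0`.

The geometry is reduced to linear algebra in `ℝ^{1,3}`. An `IdealCone` is given both by unit normals
of walls and by light-like generators. Because both descriptions are available, every supporting
plane meets the polyhedron in the part spanned by the generators on it (`support_eq_hull`), and
dimensions of faces are found by counting generators. Hence `isFace_two_iff`, `adjacent_iff` and
`isGon_iff` read the combinatorics off the Gram matrix of the normals. Finite volume
(`hvol_poly_lt_top`) holds because a polytope inscribed in the ball leaves the sphere at a linear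
rate at its vertices.

For the lattice configuration `triCone` the substantial point is `dual`, proved in `mem_vertCone`:
the triangle is triangulated so that the vertices of each piece lie on one hemisphere. What remains
is counting in `Tri m`. Infinitely many isometry classes arise because isometries are linear and
preserve the number of faces (`Congruent.encard_faces_eq`), which grows with `m`. -/

lemma lor_comm (x y : Fin 4 → ℝ) : lor x y = lor y x := by unfold lor; ring

lemma lor_add_left (x y z : Fin 4 → ℝ) : lor (x + y) z = lor x z + lor y z := by
  simp only [lor, Pi.add_apply]; ring

lemma lor_add_right (x y z : Fin 4 → ℝ) : lor x (y + z) = lor x y + lor x z := by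
  simp only [lor, Pi.add_apply]; ring

lemma lor_sub_left (x y z : Fin 4 → ℝ) : lor (x - y) z = lor x z - lor y z := by
  simp only [lor, Pi.sub_apply]; ring

lemma lor_sub_right (x y z : Fin 4 → ℝ) : lor x (y - z) = lor x y - lor x z := by
  simp only [lor, Pi.sub_apply]; ring

lemma lor_smul_left (c : ℝ) (x y : Fin 4 → ℝ) : lor (c • x) y = c * lor x y := by
  simp only [lor, Pi.smul_apply, smul_eq_mul]; ring

lemma lor_smul_right (c : ℝ) (x y : Fin 4 → ℝ) : lor x (c • y) = c * lor x y := by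
  simp only [lor, Pi.smul_apply, smul_eq_mul]; ring

lemma lor_neg_right (x y : Fin 4 → ℝ) : lor x (-y) = -lor x y := by
  simp only [lor, Pi.neg_apply]; ring

lemma lor_zero_left (x : Fin 4 → ℝ) : lor 0 x = 0 := by simp [lor]

lemma lor_zero_right (x : Fin 4 → ℝ) : lor x 0 = 0 := by simp [lor]

/-- Pairing with `y` as a linear functional. -/
def lorLin (y : Fin 4 → ℝ) : (Fin 4 → ℝ) →ₗ[ℝ] ℝ where
  toFun x := lor x y
  map_add' x z := lor_add_left x z y
  map_smul' c x := lor_smul_left c x y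

@[simp] lemma lorLin_apply (x y : Fin 4 → ℝ) : lorLin y x = lor x y := rfl

lemma lor_sum_left {ι : Type*} (s : Finset ι) (c : ι → ℝ) (w : ι → Fin 4 → ℝ) (y : Fin 4 → ℝ) :
    lor (∑ j ∈ s, c j • w j) y = ∑ j ∈ s, c j * lor (w j) y := by
  rw [← lorLin_apply, map_sum]
  exact Finset.sum_congr rfl fun j _ => lor_smul_left _ _ _

lemma continuous_lor_left (y : Fin 4 → ℝ) : Continuous fun x => lor x y := by
  unfold lor; fun_prop

lemma eq_zero_of_lor_eq_zero {x : Fin 4 → ℝ} (h : ∀ y, lor x y = 0) : x = 0 := by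
  have h0 := h (Pi.single 0 1)
  have h1 := h (Pi.single 1 1)
  have h2 := h (Pi.single 2 1)
  have h3 := h (Pi.single 3 1)
  simp [lor] at h0 h1 h2 h3
  ext i
  fin_cases i <;> simp [*]

/-- A vector orthogonal to a timelike vector is spacelike or zero. -/
lemma lor_self_nonneg_of_orthogonal {t x : Fin 4 → ℝ} (ht : lor t t < 0) (h : lor x t = 0) :
    0 ≤ lor x x ∧ (lor x x = 0 → x = 0) := by
  simp only [lor] at *
  have cs : (x 1 * t 1 + x 2 * t 2 + x 3 * t 3) ^ 2 ≤
      (x 1 ^ 2 + x 2 ^ 2 + x 3 ^ 2) * (t 1 ^ 2 + t 2 ^ 2 + t 3 ^ 2) := by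
    nlinarith [sq_nonneg (x 1 * t 2 - x 2 * t 1), sq_nonneg (x 1 * t 3 - x 3 * t 1),
      sq_nonneg (x 2 * t 3 - x 3 * t 2)]
  have e : x 1 * t 1 + x 2 * t 2 + x 3 * t 3 = x 0 * t 0 := by linarith
  rw [e] at cs
  set X := x 1 ^ 2 + x 2 ^ 2 + x 3 ^ 2 with hX
  set T := t 1 ^ 2 + t 2 ^ 2 + t 3 ^ 2 with hT
  have hTt : T < t 0 ^ 2 := by rw [hT]; nlinarith
  have hT0 : 0 ≤ T := by positivity
  have hX0 : 0 ≤ X := by positivity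
  have key : (x 0 ^ 2 - X) * t 0 ^ 2 ≤ -(X * (t 0 ^ 2 - T)) := by nlinarith
  have hpos : 0 < t 0 ^ 2 := by linarith
  have hX1 : x 0 ^ 2 ≤ X := by
    by_contra hc
    push Not at hc
    nlinarith [mul_pos (sub_pos.2 hc) hpos, mul_nonneg hX0 (sub_pos.2 hTt).le]
  refine ⟨by nlinarith, fun hz => ?_⟩
  have hx0 : x 0 ^ 2 = X := by rw [hX]; nlinarith
  have hXz : X = 0 := by
    rw [hx0] at key
    have : X * (t 0 ^ 2 - T) ≤ 0 := by nlinarith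
    by_contra hne
    have := mul_pos (lt_of_le_of_ne hX0 (Ne.symm hne)) (sub_pos.2 hTt)
    linarith
  have a0 : x 0 = 0 := by rw [hXz] at hx0; exact pow_eq_zero_iff (by norm_num) |>.1 hx0
  have a1 : x 1 = 0 := by
    refine pow_eq_zero_iff (n := 2) (by norm_num) |>.1 ?_
    linarith [sq_nonneg (x 1), sq_nonneg (x 2), sq_nonneg (x 3)]
  have a2 : x 2 = 0 := by
    refine pow_eq_zero_iff (n := 2) (by norm_num) |>.1 ?_
    linarith [sq_nonneg (x 1), sq_nonneg (x 2), sq_nonneg (x 3)]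
  have a3 : x 3 = 0 := by
    refine pow_eq_zero_iff (n := 2) (by norm_num) |>.1 ?_
    linarith [sq_nonneg (x 1), sq_nonneg (x 2), sq_nonneg (x 3)]
  ext i
  fin_cases i <;> simpa

/-- The difference `e - f` is orthogonal to a timelike vector and has norm `2 - 2 * lor e f ≤ 0`, so
it vanishes. -/
lemma eq_of_orthogonal_of_one_le {t e f : Fin 4 → ℝ} (ht : lor t t < 0) (he : lor e e = 1)
    (hf : lor f f = 1) (het : lor t e = 0) (hft : lor t f = 0) (h : 1 ≤ lor e f) : e = f := by
  have hd : lor (e - f) t = 0 := by rw [lor_sub_left, lor_comm e, lor_comm f, het, hft, sub_zero]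
  have hn : lor (e - f) (e - f) = 2 - 2 * lor e f := by
    rw [lor_sub_left, lor_sub_right, lor_sub_right, he, hf, lor_comm f e]; ring
  obtain ⟨h1, h2⟩ := lor_self_nonneg_of_orthogonal ht hd
  exact sub_eq_zero.1 (h2 (by linarith))

/-! ### Points of hyperbolic space -/

/-- Scaling of a future timelike vector to the hyperboloid. -/
def toH3 (x : Fin 4 → ℝ) (h : lor x x < 0) (h0 : 0 < x 0) : H3 :=
  ⟨(Real.sqrt (-lor x x))⁻¹ • x, by
    have hs : 0 < Real.sqrt (-lor x x) := Real.sqrt_pos.2 (by linarith)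
    have hq : Real.sqrt (-lor x x) * Real.sqrt (-lor x x) = -lor x x :=
      Real.mul_self_sqrt (by linarith)
    constructor
    · rw [lor_smul_left, lor_smul_right]
      field_simp
      nlinarith
    · simp only [Pi.smul_apply, smul_eq_mul]; positivity⟩

lemma exists_toH3_eq (x : Fin 4 → ℝ) (h : lor x x < 0) (h0 : 0 < x 0) :
    ∃ c : ℝ, 0 < c ∧ (toH3 x h h0).1 = c • x :=
  ⟨_, inv_pos.2 (Real.sqrt_pos.2 (by linarith)), rfl⟩

/-- Radial projection to the hyperplane `x 0 = 1`. -/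
def radial (x : Fin 4 → ℝ) : EuclideanSpace ℝ (Fin 3) := WithLp.toLp 2 fun i => x i.succ / x 0

lemma klein_eq_radial (x : H3) : klein x = radial x.1 := rfl

lemma radial_smul {c : ℝ} (hc : c ≠ 0) (x : Fin 4 → ℝ) : radial (c • x) = radial x := by
  ext i
  simp [radial, mul_div_mul_left _ _ hc]

lemma norm_radial_sq {x : Fin 4 → ℝ} (h : x 0 ≠ 0) :
    ‖radial x‖ ^ 2 = 1 + lor x x / x 0 ^ 2 := by
  rw [EuclideanSpace.norm_sq_eq]
  simp only [radial, Fin.sum_univ_three, Real.norm_eq_abs, sq_abs, lor]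
  have e1 : (Fin.succ 0 : Fin 4) = 1 := rfl
  have e2 : (Fin.succ 1 : Fin 4) = 2 := rfl
  have e3 : (Fin.succ 2 : Fin 4) = 3 := rfl
  rw [e1, e2, e3]
  field_simp
  ring

lemma norm_klein_lt_one (x : H3) : ‖klein x‖ < 1 := by
  have h := norm_radial_sq (x := x.1) x.2.2.ne'
  rw [x.2.1] at h
  have : -1 / x.1 0 ^ 2 < 0 := div_neg_of_neg_of_pos (by norm_num) (pow_pos x.2.2 2)
  rw [klein_eq_radial]
  nlinarith [norm_nonneg (radial x.1)]

/-- The reversed Cauchy-Schwarz inequality on the hyperboloid. -/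
lemma one_le_neg_lor (x y : H3) : 1 ≤ -lor x.1 y.1 := by
  have hx := x.2.1
  have hy := y.2.1
  have hx0 := x.2.2
  have hy0 := y.2.2
  by_contra hc
  push Not at hc
  -- The component of `x` orthogonal to `y` is spacelike, which gives `lor x y ^ 2 ≥ 1`;
  -- Cauchy-Schwarz on the spatial parts then fixes the sign.
  have hd : lor (x.1 + lor x.1 y.1 • y.1) y.1 = 0 := by
    rw [lor_add_left, lor_smul_left, hy]; ring
  have hn : lor (x.1 + lor x.1 y.1 • y.1) (x.1 + lor x.1 y.1 • y.1) = -1 + lor x.1 y.1 ^ 2 := by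
    rw [lor_add_left, lor_add_right, lor_add_right, lor_smul_left, lor_smul_right, lor_smul_left,
      lor_smul_right, hx, hy, lor_comm y.1 x.1]
    ring
  have h1 := (lor_self_nonneg_of_orthogonal (t := y.1) (by linarith) hd).1
  have h2 : 0 < -lor x.1 y.1 := by
    simp only [lor] at *
    have cs : (x.1 1 * y.1 1 + x.1 2 * y.1 2 + x.1 3 * y.1 3) ^ 2 ≤
        (x.1 1 ^ 2 + x.1 2 ^ 2 + x.1 3 ^ 2) * (y.1 1 ^ 2 + y.1 2 ^ 2 + y.1 3 ^ 2) := by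
      nlinarith [sq_nonneg (x.1 1 * y.1 2 - x.1 2 * y.1 1),
        sq_nonneg (x.1 1 * y.1 3 - x.1 3 * y.1 1), sq_nonneg (x.1 2 * y.1 3 - x.1 3 * y.1 2)]
    have e1 : x.1 1 ^ 2 + x.1 2 ^ 2 + x.1 3 ^ 2 = x.1 0 ^ 2 - 1 := by linarith
    have e2 : y.1 1 ^ 2 + y.1 2 ^ 2 + y.1 3 ^ 2 = y.1 0 ^ 2 - 1 := by linarith
    rw [e1, e2] at cs
    have hb : 0 ≤ x.1 1 ^ 2 + x.1 2 ^ 2 + x.1 3 ^ 2 := by positivity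
    have hb' : 0 ≤ y.1 1 ^ 2 + y.1 2 ^ 2 + y.1 3 ^ 2 := by positivity
    have lt : (x.1 1 * y.1 1 + x.1 2 * y.1 2 + x.1 3 * y.1 3) ^ 2 < (x.1 0 * y.1 0) ^ 2 := by
      nlinarith
    have := abs_lt_of_sq_lt_sq lt (by positivity)
    linarith [(abs_lt.1 this).2]
  rw [hn] at h1
  nlinarith

lemma lor_eq_of_hdist_eq {x y x' y' : H3} (h : hdist x y = hdist x' y') :
    lor x.1 y.1 = lor x'.1 y'.1 := by
  have := Real.arcosh_injOn (one_le_neg_lor x y) (one_le_neg_lor x' y') h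
  linarith

/-! ### Isometries -/

lemma exists_basis_H3 : ∃ p : Fin 4 → H3, ∀ x : Fin 4 → ℝ, (∀ i, lor x (p i).1 = 0) → x = 0 := by
  have h2 : Real.sqrt 2 * Real.sqrt 2 = 2 := Real.mul_self_sqrt (by norm_num)
  refine ⟨![⟨![1, 0, 0, 0], by simp [lor]⟩, ⟨![Real.sqrt 2, 1, 0, 0], by simp [lor]; linarith⟩,
    ⟨![Real.sqrt 2, 0, 1, 0], by simp [lor]; linarith⟩,
    ⟨![Real.sqrt 2, 0, 0, 1], by simp [lor]; linarith⟩], fun x hx => ?_⟩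
  have a0 := hx 0
  have a1 := hx 1
  have a2 := hx 2
  have a3 := hx 3
  simp [lor] at a0 a1 a2 a3
  simp [a0] at a1 a2 a3
  ext i
  fin_cases i <;> simpa

/-- An isometry of `H3` is the restriction of a linear automorphism preserving `lor`. -/
lemma exists_linear_of_isometry (f : H3 ≃ H3) (hf : ∀ x y, hdist (f x) (f y) = hdist x y) :
    ∃ L : (Fin 4 → ℝ) ≃ₗ[ℝ] (Fin 4 → ℝ), (∀ x y, lor (L x) (L y) = lor x y) ∧
      ∀ x : H3, (f x).1 = L x.1 := by
  have hl : ∀ x y, lor (f x).1 (f y).1 = lor x.1 y.1 := fun x y => lor_eq_of_hdist_eq (hf x y)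
  obtain ⟨p, hp⟩ := exists_basis_H3
  -- Independence depends only on the Gram matrix: a relation among the `q i` yields the same
  -- combination of the `p i` orthogonal to every `p i`, hence zero. So the images of the basis
  -- again form a basis.
  have indep : ∀ q : Fin 4 → H3, (∀ i j, lor (q i).1 (q j).1 = lor (p i).1 (p j).1) →
      LinearIndependent ℝ fun i => (q i).1 := by
    intro q hq
    have hpi : LinearIndependent ℝ fun i => (p i).1 := by
      let T : (Fin 4 → ℝ) →ₗ[ℝ] (Fin 4 → ℝ) := LinearMap.pi fun i => lorLin (p i).1
      have hT : Function.Injective T := by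
        rw [injective_iff_map_eq_zero]
        intro x hx
        exact hp x fun i => congrFun hx i
      have hTs : Function.Surjective T := LinearMap.injective_iff_surjective.1 hT
      rw [Fintype.linearIndependent_iff]
      intro g hg i
      obtain ⟨y, hy⟩ := hTs (Pi.single i 1)
      have h1 : lor (∑ j, g j • (p j).1) y = 0 := by rw [hg, lor_zero_left]
      rw [lor_sum_left] at h1
      have h2 : ∀ j, lor (p j).1 y = (Pi.single i 1 : Fin 4 → ℝ) j := fun j => by
        rw [lor_comm, ← hy]; rfl
      simpa [h2, Pi.single_apply] using h1
    rw [Fintype.linearIndependent_iff] at hpi ⊢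
    intro g hg
    apply hpi g
    refine hp _ fun i => ?_
    rw [lor_sum_left]
    simp_rw [← hq]
    rw [← lor_sum_left, hg, lor_zero_left]
  have hip := indep p fun _ _ => rfl
  have hiq := indep (fun i => f (p i)) fun i j => hl _ _
  let bp := basisOfLinearIndependentOfCardEqFinrank hip (by simp)
  let bq := basisOfLinearIndependentOfCardEqFinrank hiq (by simp)
  let L := bp.equiv bq (Equiv.refl _)
  have hbp : ∀ i, bp i = (p i).1 := fun i => by simp [bp]
  have hLp : ∀ i, L (p i).1 = (f (p i)).1 := fun i => by
    rw [← hbp, Module.Basis.equiv_apply]; simp [bq]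
  have expand : ∀ x, x = ∑ i, bp.repr x i • (p i).1 := fun x => by
    conv_lhs => rw [← bp.sum_repr x]
    simp [hbp]
  have h1 : ∀ x i, lor (L x) (f (p i)).1 = lor x (p i).1 := by
    intro x i
    rw [expand x, map_sum]
    simp_rw [map_smul, hLp, lor_sum_left, hl]
  have hL : ∀ x y, lor (L x) (L y) = lor x y := by
    intro x y
    rw [expand y, map_sum, lor_comm, lor_comm x]
    simp_rw [map_smul, hLp, lor_sum_left]
    refine Finset.sum_congr rfl fun i _ => ?_
    rw [lor_comm, h1, lor_comm]
  refine ⟨L, hL, fun x => ?_⟩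
  refine sub_eq_zero.1 (eq_zero_of_lor_eq_zero fun y => ?_)
  obtain ⟨z, rfl⟩ := L.surjective y
  rw [expand z, map_sum, lor_comm]
  simp_rw [map_smul, hLp, lor_sum_left]
  refine Finset.sum_eq_zero fun i _ => ?_
  rw [lor_sub_right, lor_comm, hl, lor_comm _ (L x.1), h1, sub_self, mul_zero]

lemma isFace_image {P F : Set H3} {k : ℕ} (f : H3 ≃ H3)
    (hf : ∀ x y, hdist (f x) (f y) = hdist x y) (h : IsFace P k F) :
    IsFace (f '' P) k (f '' F) := by
  obtain ⟨L, hL, hfL⟩ := exists_linear_of_isometry f hf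
  obtain ⟨⟨e, he, hle, hF⟩, hk⟩ := h
  refine ⟨⟨L e, by rw [hL, he], ?_, ?_⟩, ?_⟩
  · rintro _ ⟨x, hx, rfl⟩
    rw [hfL, hL]
    exact hle x hx
  · ext y
    obtain ⟨x, rfl⟩ := f.surjective y
    simp only [f.injective.mem_set_image, Set.mem_ofPred_eq, hF, hfL, hL]
  · have : (fun x : H3 => x.1) '' (f '' F) = L '' ((fun x : H3 => x.1) '' F) := by
      rw [Set.image_image, Set.image_image]
      exact Set.image_congr fun x _ => hfL x
    rw [this]
    have h2 : Submodule.span ℝ (L '' ((fun x : H3 => x.1) '' F)) =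
        (Submodule.span ℝ ((fun x : H3 => x.1) '' F)).map (L : (Fin 4 → ℝ) →ₗ[ℝ] (Fin 4 → ℝ)) := by
      rw [Submodule.map_span]; rfl
    rw [h2, LinearEquiv.finrank_map_eq, hk]

/-- The number of faces is an isometry invariant. -/
lemma Congruent.encard_faces_eq {P Q : Set H3} (h : Congruent P Q) :
    (faces P).encard = (faces Q).encard := by
  have le : ∀ {P Q : Set H3}, Congruent P Q → (faces P).encard ≤ (faces Q).encard := by
    rintro P Q ⟨f, hf, rfl⟩
    refine Set.encard_le_encard_of_injOn (f := fun F => f '' F) ?_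
      (f.injective.image_injective.injOn)
    intro F hF
    exact isFace_image f hf hF
  exact le_antisymm (le h) (le (congruence.iseqv.symm h))

/-! ### Cones spanned by light-like vectors -/

/-- A polyhedral cone in `ℝ^{1,3}`, given both by finitely many unit normals `e i` and by finitely
many light-like generators `w j`, whose walls enclose the angle `π / 3` or do not meet in the
interior of the light cone. -/
structure IdealCone (I J : Type) [Fintype J] where
  e : I → Fin 4 → ℝ
  w : J → Fin 4 → ℝ
  center : Fin 4 → ℝ
  e_unit : ∀ i, lor (e i) (e i) = 1
  w_null : ∀ j, lor (w j) (w j) = 0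
  w_pos : ∀ j, 0 < w j 0
  w_neg : ∀ j k, j ≠ k → lor (w j) (w k) < 0
  w_le : ∀ j i, lor (w j) (e i) ≤ 0
  dual : ∀ x, (∀ i, lor x (e i) ≤ 0) → ∃ c : J → ℝ, (∀ j, 0 ≤ c j) ∧ x = ∑ j, c j • w j
  center_neg : lor center center < 0
  center_pos : 0 < center 0
  center_lt : ∀ i, lor center (e i) < 0
  three : ∀ i, ∃ j k l, j ≠ k ∧ j ≠ l ∧ k ≠ l ∧
    lor (w j) (e i) = 0 ∧ lor (w k) (e i) = 0 ∧ lor (w l) (e i) = 0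
  walls : ∀ i i', i ≠ i' → lor (e i) (e i') ≤ -1 ∨ (lor (e i) (e i') = -1 / 2 ∧
    ∃ j k, j ≠ k ∧ lor (w j) (e i) = 0 ∧ lor (w k) (e i) = 0 ∧
      lor (w j) (e i') = 0 ∧ lor (w k) (e i') = 0)

namespace IdealCone

variable {I J : Type} [Fintype J] (C : IdealCone I J)

/-- The polyhedron cut out by the cone. -/
def poly : Set H3 := {x | ∀ i, lor x.1 (C.e i) ≤ 0}

/-- The part of the polyhedron on the `i`-th wall. -/
def face (i : I) : Set H3 := {x | x ∈ C.poly ∧ lor x.1 (C.e i) = 0}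

/-- The points of `H3` in the cone spanned by the generators with indices in `K`. -/
def hull (K : Set J) : Set H3 :=
  {x | ∃ c : J → ℝ, (∀ j, 0 ≤ c j) ∧ (∀ j ∉ K, c j = 0) ∧ x.1 = ∑ j, c j • C.w j}

/-- The generators on which `e` vanishes. -/
def zeros (e : Fin 4 → ℝ) : Set J := {j | lor (C.w j) e = 0}

lemma lor_pair_neg {j k : J} (h : j ≠ k) {s : ℝ} (hs : 0 < s) :
    lor (C.w j + s • C.w k) (C.w j + s • C.w k) < 0 := by
  have := C.w_neg j k h
  rw [lor_add_left, lor_add_right, lor_add_right, lor_smul_left, lor_smul_right, lor_smul_left,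
    lor_smul_right, C.w_null, C.w_null, lor_comm (C.w k)]
  nlinarith

lemma pair_pos (j k : J) {s : ℝ} (hs : 0 < s) : 0 < (C.w j + s • C.w k) 0 := by
  have := C.w_pos j
  have := C.w_pos k
  simp only [Pi.add_apply, Pi.smul_apply, smul_eq_mul]
  positivity

lemma hull_subset_poly (K : Set J) : C.hull K ⊆ C.poly := by
  rintro x ⟨c, hc, -, hx⟩ i
  rw [hx, lor_sum_left]
  exact Finset.sum_nonpos fun j _ => mul_nonpos_of_nonneg_of_nonpos (hc j) (C.w_le j i)

lemma pair_mem_hull {K : Set J} {j k : J} (h : j ≠ k) (hj : j ∈ K) (hk : k ∈ K) {s : ℝ}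
    (hs : 0 < s) : toH3 _ (C.lor_pair_neg h hs) (C.pair_pos j k hs) ∈ C.hull K := by
  classical
  obtain ⟨c, hc, hx⟩ := exists_toH3_eq _ (C.lor_pair_neg h hs) (C.pair_pos j k hs)
  refine ⟨fun l => c * ((if l = j then 1 else 0) + if l = k then s else 0), fun l => ?_,
    fun l hl => ?_, ?_⟩
  · dsimp only; positivity
  · dsimp only
    rw [if_neg (by rintro rfl; exact hl hj), if_neg (by rintro rfl; exact hl hk)]; simp
  · rw [hx]
    simp_rw [mul_smul, ← Finset.smul_sum, add_smul, Finset.sum_add_distrib, ite_smul]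
    simp

/-! ### Supporting planes of the cone -/

section Supporting

variable {e : Fin 4 → ℝ}

/-- The generators are not points of `H3`, so they are approached by the points `w j + s • w k` with
small `s`. -/
lemma lor_w_nonpos [Nontrivial J] (he : ∀ x ∈ C.poly, lor x.1 e ≤ 0) (j : J) :
    lor (C.w j) e ≤ 0 := by
  obtain ⟨k, hk⟩ := exists_ne j
  by_contra hc
  push Not at hc
  set a := lor (C.w j) e with ha
  set b := lor (C.w k) e with hb
  -- With `s = a / (|b| + 1)` the value `a + s * b` at `w j + s • w k` is still positive.
  have hs : 0 < a / (|b| + 1) := by positivity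
  have hm := he _ (C.hull_subset_poly Set.univ (C.pair_mem_hull hk.symm (Set.mem_univ j) (Set.mem_univ k) hs))
  obtain ⟨c, hc', hx⟩ := exists_toH3_eq _ (C.lor_pair_neg hk.symm hs) (C.pair_pos j k hs)
  rw [hx, lor_smul_left, lor_add_left, lor_smul_left, ← ha, ← hb] at hm
  have h1 : 0 < a + a / (|b| + 1) * b := by
    have h2 : a + a / (|b| + 1) * b = a / (|b| + 1) * (|b| + 1 + b) := by field_simp
    rw [h2]
    have := neg_abs_le b
    exact mul_pos hs (by linarith)
  nlinarith [mul_pos hc' h1]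

lemma lor_nonpos_of_cone [Nontrivial J] (he : ∀ x ∈ C.poly, lor x.1 e ≤ 0) {y : Fin 4 → ℝ}
    (hy : ∀ i, lor y (C.e i) ≤ 0) : lor y e ≤ 0 := by
  obtain ⟨c, hc, rfl⟩ := C.dual y hy
  rw [lor_sum_left]
  exact Finset.sum_nonpos fun j _ => mul_nonpos_of_nonneg_of_nonpos (hc j) (C.lor_w_nonpos he j)

/-- The part of the polyhedron on a supporting plane is spanned by the generators on it. -/
lemma support_eq_hull [Nontrivial J] (he : ∀ x ∈ C.poly, lor x.1 e ≤ 0) :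
    {x | x ∈ C.poly ∧ lor x.1 e = 0} = C.hull (C.zeros e) := by
  ext x
  constructor
  · rintro ⟨hx, h0⟩
    obtain ⟨c, hc, hxc⟩ := C.dual x.1 hx
    refine ⟨c, hc, fun j hj => ?_, hxc⟩
    rw [hxc, lor_sum_left, Finset.sum_eq_zero_iff_of_nonpos fun j _ =>
      mul_nonpos_of_nonneg_of_nonpos (hc j) (C.lor_w_nonpos he j)] at h0
    exact (mul_eq_zero.1 (h0 j (Finset.mem_univ j))).resolve_right hj
  · intro h
    refine ⟨C.hull_subset_poly _ h, ?_⟩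
    obtain ⟨c, hc, hz, hx⟩ := h
    rw [hx, lor_sum_left]
    refine Finset.sum_eq_zero fun j _ => ?_
    by_cases hj : j ∈ C.zeros e
    · have : lor (C.w j) e = 0 := hj
      rw [this, mul_zero]
    · rw [hz j hj, zero_mul]

/-- Along a direction that leaves a supporting half-space at a boundary point of the cone, one
leaves a wall through this point. -/
lemma exists_wall [Nontrivial J] [Finite I] (he : ∀ x ∈ C.poly, lor x.1 e ≤ 0) {x y : Fin 4 → ℝ}
    (hx : ∀ i, lor x (C.e i) ≤ 0) (hx0 : lor x e = 0) (hy : 0 < lor y e) :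
    ∃ i, lor x (C.e i) = 0 ∧ 0 < lor y (C.e i) := by
  by_contra hc
  push Not at hc
  -- If no wall through `x` is crossed, a short move along `y` stays in the cone, although `lor · e`
  -- becomes positive.
  have hev : ∀ᶠ s : ℝ in nhdsWithin 0 (Set.Ioi 0), ∀ i, lor (x + s • y) (C.e i) ≤ 0 := by
    rw [Filter.eventually_all]
    intro i
    simp only [lor_add_left, lor_smul_left]
    rcases (hx i).lt_or_eq with h | h
    · have hcont : Continuous fun s : ℝ => lor x (C.e i) + s * lor y (C.e i) := by fun_prop
      have := (hcont.tendsto 0).eventually (gt_mem_nhds (show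
        lor x (C.e i) + 0 * lor y (C.e i) < 0 by simpa using h))
      exact (this.filter_mono nhdsWithin_le_nhds).mono fun s hs => hs.le
    · filter_upwards [self_mem_nhdsWithin] with s hs
      rw [h, zero_add]
      exact mul_nonpos_of_nonneg_of_nonpos (le_of_lt hs) (hc i h)
  obtain ⟨s, hs, hs0⟩ := (hev.and self_mem_nhdsWithin).exists
  have := C.lor_nonpos_of_cone he hs
  rw [lor_add_left, lor_smul_left, hx0, zero_add] at this
  exact absurd this (not_le.2 (mul_pos hs0 hy))

/-- A supporting plane through the centre would, by `exists_wall` in the direction `e`, force a wall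
through the centre. -/
lemma lor_center_neg [Nontrivial J] [Finite I] (h1 : lor e e = 1)
    (he : ∀ x ∈ C.poly, lor x.1 e ≤ 0) : lor C.center e < 0 := by
  refine lt_of_le_of_ne (C.lor_nonpos_of_cone he fun i => (C.center_lt i).le) fun h => ?_
  obtain ⟨i, hi, -⟩ := C.exists_wall he (fun i => (C.center_lt i).le) h (y := e) (by linarith)
  exact (C.center_lt i).ne hi

end Supporting

lemma lor_e_nonpos (i : I) : ∀ x ∈ C.poly, lor x.1 (C.e i) ≤ 0 := fun _ hx => hx i

lemma face_eq_hull [Nontrivial J] (i : I) : C.face i = C.hull (C.zeros (C.e i)) :=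
  C.support_eq_hull (C.lor_e_nonpos i)

/-- Both terms of `lor x (e i + e i')` are nonpositive on the polyhedron, so their sum vanishes only
if both do. Thus `e i + e i'` supports the polyhedron along the common part; it is a unit vector
exactly when the walls enclose `π / 3`. -/
lemma face_inter [Nontrivial J] (i i' : I) :
    C.face i ∩ C.face i' = {x | x ∈ C.poly ∧ lor x.1 (C.e i + C.e i') = 0} := by
  ext x
  simp only [face, Set.mem_inter_iff, Set.mem_ofPred_eq, lor_add_right]
  constructor
  · rintro ⟨⟨h, h1⟩, -, h2⟩
    exact ⟨h, by rw [h1, h2, add_zero]⟩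
  · rintro ⟨h, h1⟩
    have a := h i
    have b := h i'
    exact ⟨⟨h, by linarith⟩, h, by linarith⟩

lemma zeros_add (i i' : I) :
    C.zeros (C.e i + C.e i') = C.zeros (C.e i) ∩ C.zeros (C.e i') := by
  ext j
  simp only [zeros, Set.mem_inter_iff, Set.mem_ofPred_eq, lor_add_right]
  have a := C.w_le j i
  have b := C.w_le j i'
  constructor
  · intro h; constructor <;> linarith
  · rintro ⟨h1, h2⟩; rw [h1, h2, add_zero]

lemma face_inter_eq_hull [Nontrivial J] (i i' : I) :
    C.face i ∩ C.face i' = C.hull (C.zeros (C.e i) ∩ C.zeros (C.e i')) := by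
  rw [face_inter, C.support_eq_hull, zeros_add]
  intro x hx
  rw [lor_add_right]
  linarith [hx i, hx i']

/-! ### Dimensions -/

/-- The Gram matrix has zero diagonal and negative off-diagonal entries `a, b, c`, so its
determinant `2abc` is nonzero. -/
lemma linearIndependent_three {j k l : J} (hjk : j ≠ k) (hjl : j ≠ l) (hkl : k ≠ l) :
    LinearIndependent ℝ ![C.w j, C.w k, C.w l] := by
  rw [Fintype.linearIndependent_iff]
  intro g hg
  simp only [Fin.sum_univ_three, Matrix.cons_val_zero, Matrix.cons_val_one, Matrix.cons_val] at hg
  have a := C.w_neg j k hjk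
  have b := C.w_neg j l hjl
  have c := C.w_neg k l hkl
  have pair : ∀ m, g 0 * lor (C.w j) (C.w m) + g 1 * lor (C.w k) (C.w m) +
      g 2 * lor (C.w l) (C.w m) = 0 := fun m => by
    rw [← lor_smul_left, ← lor_smul_left, ← lor_smul_left, ← lor_add_left, ← lor_add_left, hg,
      lor_zero_left]
  have h1 := pair j
  have h2 := pair k
  have h3 := pair l
  rw [C.w_null, lor_comm (C.w k), lor_comm (C.w l)] at h1
  rw [C.w_null, lor_comm (C.w l)] at h2
  rw [C.w_null] at h3
  have g2 : g 2 = 0 := by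
    have : g 2 * (lor (C.w j) (C.w l) * lor (C.w k) (C.w l)) = 0 := by
      linear_combination (1 / 2 * lor (C.w k) (C.w l)) * h1 + (1 / 2 * lor (C.w j) (C.w l)) * h2 -
        (1 / 2 * lor (C.w j) (C.w k)) * h3
    exact (mul_eq_zero.1 this).resolve_right (mul_pos_of_neg_of_neg b c).ne'
  rw [g2] at h1 h2
  have g1 : g 1 = 0 := (mul_eq_zero.1 (by linarith : g 1 * lor (C.w j) (C.w k) = 0)).resolve_right a.ne
  have g0 : g 0 = 0 := (mul_eq_zero.1 (by linarith : g 0 * lor (C.w j) (C.w k) = 0)).resolve_right a.ne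
  intro i
  fin_cases i <;> simpa

lemma linearIndependent_two {j k : J} (hjk : j ≠ k) : LinearIndependent ℝ ![C.w j, C.w k] := by
  rw [LinearIndependent.pair_iff]
  intro s t h
  have a := C.w_neg j k hjk
  have h1 : lor (s • C.w j + t • C.w k) (C.w j) = 0 := by rw [h, lor_zero_left]
  have h2 : lor (s • C.w j + t • C.w k) (C.w k) = 0 := by rw [h, lor_zero_left]
  rw [lor_add_left, lor_smul_left, lor_smul_left, C.w_null, lor_comm (C.w k)] at h1
  rw [lor_add_left, lor_smul_left, lor_smul_left, C.w_null] at h2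
  exact ⟨(mul_eq_zero.1 (by linarith : s * lor (C.w j) (C.w k) = 0)).resolve_right a.ne,
    (mul_eq_zero.1 (by linarith : t * lor (C.w j) (C.w k) = 0)).resolve_right a.ne⟩

/-- The linear span of the points of `F`. -/
abbrev spanOf (F : Set H3) : Submodule ℝ (Fin 4 → ℝ) :=
  Submodule.span ℝ ((fun x : H3 => x.1) '' F)

lemma spanOf_hull_le (K : Set J) : spanOf (C.hull K) ≤ Submodule.span ℝ (C.w '' K) := by
  rw [Submodule.span_le]
  rintro _ ⟨x, ⟨c, -, hz, hx⟩, rfl⟩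
  dsimp only
  rw [hx]
  refine Submodule.sum_mem _ fun j _ => ?_
  by_cases hj : j ∈ K
  · exact Submodule.smul_mem _ _ (Submodule.subset_span ⟨j, hj, rfl⟩)
  · rw [hz j hj, zero_smul]; exact Submodule.zero_mem _

lemma w_mem_spanOf_hull {K : Set J} {j k : J} (h : j ≠ k) (hj : j ∈ K) (hk : k ∈ K) :
    C.w j ∈ spanOf (C.hull K) := by
  have key : ∀ s : ℝ, 0 < s → C.w j + s • C.w k ∈ spanOf (C.hull K) := by
    intro s hs
    obtain ⟨c, hc, hx⟩ := exists_toH3_eq _ (C.lor_pair_neg h hs) (C.pair_pos j k hs)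
    have h1 : c • (C.w j + s • C.w k) ∈ spanOf (C.hull K) := by
      rw [← hx]
      exact Submodule.subset_span ⟨_, C.pair_mem_hull h hj hk hs, rfl⟩
    exact (Submodule.smul_mem_iff _ hc.ne').1 h1
  -- `w j = 2 (w j + w k) - (w j + 2 w k)`, and both brackets are multiples of points of the hull.
  have h3 := Submodule.sub_mem _ (Submodule.smul_mem _ 2 (key 1 one_pos)) (key 2 two_pos)
  convert h3 using 1
  module

lemma finrank_spanOf_hull_le (K : Set J) :
    Module.finrank ℝ (spanOf (C.hull K)) ≤ K.ncard := by
  classical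
  have h1 := Submodule.finrank_mono (C.spanOf_hull_le K)
  have h2 : Module.finrank ℝ (Submodule.span ℝ (C.w '' K)) ≤ (C.w '' K).ncard := by
    rw [Set.ncard_eq_toFinset_card' (C.w '' K)]
    exact finrank_span_le_card _
  exact h1.trans (h2.trans (Set.ncard_image_le K.toFinite))

lemma two_le_finrank_spanOf_hull {K : Set J} {j k : J} (h : j ≠ k) (hj : j ∈ K) (hk : k ∈ K) :
    2 ≤ Module.finrank ℝ (spanOf (C.hull K)) := by
  have h1 := finrank_span_eq_card (C.linearIndependent_two h)
  rw [Fintype.card_fin] at h1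
  refine h1.symm.le.trans (Submodule.finrank_mono ?_)
  rw [Submodule.span_le]
  rintro _ ⟨i, rfl⟩
  fin_cases i
  · exact C.w_mem_spanOf_hull h hj hk
  · exact C.w_mem_spanOf_hull h.symm hk hj

lemma three_le_finrank_spanOf_hull {K : Set J} {j k l : J} (hjk : j ≠ k) (hjl : j ≠ l)
    (hkl : k ≠ l) (hj : j ∈ K) (hk : k ∈ K) (hl : l ∈ K) :
    3 ≤ Module.finrank ℝ (spanOf (C.hull K)) := by
  have h1 := finrank_span_eq_card (C.linearIndependent_three hjk hjl hkl)
  rw [Fintype.card_fin] at h1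
  refine h1.symm.le.trans (Submodule.finrank_mono ?_)
  rw [Submodule.span_le]
  rintro _ ⟨i, rfl⟩
  fin_cases i
  · exact C.w_mem_spanOf_hull hjk hj hk
  · exact C.w_mem_spanOf_hull hjk.symm hk hj
  · exact C.w_mem_spanOf_hull hjl.symm hl hj

/-- A single light-like ray contains no vector of norm `-1`. -/
lemma hull_eq_empty {K : Set J} (h : K.Subsingleton) : C.hull K = ∅ := by
  refine Set.eq_empty_of_forall_notMem ?_
  rintro x ⟨c, -, hz, hx⟩
  have hn := x.2.1
  by_cases hK : ∃ j, c j ≠ 0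
  · obtain ⟨j, hj⟩ := hK
    have : x.1 = c j • C.w j := by
      rw [hx]
      refine Finset.sum_eq_single j (fun k _ hk => ?_) (by simp)
      have hjK : j ∈ K := by by_contra h'; exact hj (hz j h')
      rw [hz k fun h' => hk (h h' hjK), zero_smul]
    rw [this, lor_smul_left, lor_smul_right, C.w_null] at hn
    norm_num at hn
  · push Not at hK
    have : x.1 = 0 := by rw [hx]; simp [hK]
    rw [this, lor_zero_left] at hn
    norm_num at hn

/-- A plane is determined by three generators on it. -/
lemma eq_or_eq_neg {j k l : J} (hjk : j ≠ k) (hjl : j ≠ l) (hkl : k ≠ l) {e f : Fin 4 → ℝ}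
    (he : lor e e = 1) (hf : lor f f = 1)
    (hej : lor (C.w j) e = 0) (hek : lor (C.w k) e = 0) (hel : lor (C.w l) e = 0)
    (hfj : lor (C.w j) f = 0) (hfk : lor (C.w k) f = 0) (hfl : lor (C.w l) f = 0) :
    f = e ∨ f = -e := by
  -- The vector `e` is not orthogonal to itself, so together with the three generators it spans
  -- `ℝ⁴`; the part of `f` orthogonal to `e` is then orthogonal to everything.
  have hind : LinearIndependent ℝ (Fin.snoc ![C.w j, C.w k, C.w l] e : Fin 4 → Fin 4 → ℝ) := by
    rw [linearIndependent_finSnoc]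
    refine ⟨C.linearIndependent_three hjk hjl hkl, fun hmem => ?_⟩
    have hle : Submodule.span ℝ (Set.range ![C.w j, C.w k, C.w l]) ≤ LinearMap.ker (lorLin e) := by
      rw [Submodule.span_le]
      rintro _ ⟨i, rfl⟩
      fin_cases i <;> simpa
    have : lor e e = 0 := hle hmem
    linarith
  have htop := hind.span_eq_top_of_card_eq_finrank' (by simp)
  have hd : f - lor f e • e = 0 := by
    refine eq_zero_of_lor_eq_zero fun y => ?_
    have hle : Submodule.span ℝ
        (Set.range (Fin.snoc ![C.w j, C.w k, C.w l] e : Fin 4 → Fin 4 → ℝ)) ≤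
        LinearMap.ker (lorLin (f - lor f e • e)) := by
      rw [Submodule.span_le]
      rintro _ ⟨i, rfl⟩
      refine Fin.lastCases ?_ (fun i => ?_) i
      · simp [lor_sub_right, lor_smul_right, he, lor_comm e f]
      · rw [Fin.snoc_castSucc]
        fin_cases i <;> simp [lor_sub_right, lor_smul_right, *]
    rw [htop] at hle
    rw [lor_comm]
    exact hle (Submodule.mem_top (x := y))
  have hfe : f = lor f e • e := sub_eq_zero.1 hd
  have h1 : lor f e * lor f e = 1 := by
    have h2 := hf
    rw [hfe, lor_smul_left, lor_smul_right, he] at h2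
    linarith
  rcases mul_self_eq_one_iff.1 h1 with h | h
  · left; rw [hfe, h, one_smul]
  · right; rw [hfe, h, neg_one_smul]

/-! ### Faces -/

set_option linter.unusedSectionVars false

variable [Nontrivial J] [Finite I]

/-- The centre lies strictly inside both half-spaces, which excludes `f = -e`. -/
lemma eq_of_three {j k l : J} (hjk : j ≠ k) (hjl : j ≠ l) (hkl : k ≠ l) {e f : Fin 4 → ℝ}
    (he : lor e e = 1) (hf : lor f f = 1)
    (hes : ∀ x ∈ C.poly, lor x.1 e ≤ 0) (hfs : ∀ x ∈ C.poly, lor x.1 f ≤ 0)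
    (hej : lor (C.w j) e = 0) (hek : lor (C.w k) e = 0) (hel : lor (C.w l) e = 0)
    (hfj : lor (C.w j) f = 0) (hfk : lor (C.w k) f = 0) (hfl : lor (C.w l) f = 0) : f = e := by
  refine (C.eq_or_eq_neg hjk hjl hkl he hf hej hek hel hfj hfk hfl).resolve_right fun h => ?_
  have h1 := C.lor_center_neg he hes
  have h2 := C.lor_center_neg hf hfs
  rw [h, lor_neg_right] at h2
  linarith

lemma e_injective : Function.Injective C.e := by
  intro i i' h
  by_contra hne
  have h1 := C.e_unit i
  rcases C.walls i i' hne with h2 | ⟨h2, -⟩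
  · rw [← h] at h2; linarith
  · rw [← h] at h2; linarith

/-- A plane whose intersection with the polyhedron contains a segment between generators contains
these generators. -/
lemma lor_w_eq_zero_of_pair {f : Fin 4 → ℝ} (hf : ∀ x ∈ C.poly, lor x.1 f ≤ 0) {j k : J}
    (h : j ≠ k) (h0 : lor (toH3 _ (C.lor_pair_neg h one_pos) (C.pair_pos j k one_pos)).1 f = 0) :
    lor (C.w j) f = 0 ∧ lor (C.w k) f = 0 := by
  obtain ⟨c, hc, hx⟩ := exists_toH3_eq _ (C.lor_pair_neg h one_pos) (C.pair_pos j k one_pos)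
  rw [hx, lor_smul_left, lor_add_left, lor_smul_left, one_mul] at h0
  have h1 := (mul_eq_zero.1 h0).resolve_left hc.ne'
  have a := C.lor_w_nonpos hf j
  have b := C.lor_w_nonpos hf k
  constructor <;> linarith

lemma zeros_of_hull_subset {f : Fin 4 → ℝ} (hf : ∀ x ∈ C.poly, lor x.1 f ≤ 0) {K : Set J}
    (hK : ∀ x ∈ C.hull K, lor x.1 f = 0) {j k : J} (h : j ≠ k) (hj : j ∈ K) (hk : k ∈ K) :
    lor (C.w j) f = 0 ∧ lor (C.w k) f = 0 :=
  C.lor_w_eq_zero_of_pair hf h (hK _ (C.pair_mem_hull h hj hk one_pos))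

lemma isOuterNormal_e (i : I) : IsOuterNormal C.poly (C.face i) (C.e i) :=
  ⟨C.e_unit i, C.lor_e_nonpos i, rfl⟩

/-- Dihedral angles are defined through arbitrary outer normals of a face; the three generators on
the face make the normal unique. -/
lemma eq_e_of_isOuterNormal {i : I} {f : Fin 4 → ℝ} (h : IsOuterNormal C.poly (C.face i) f) :
    f = C.e i := by
  obtain ⟨h1, h2, h3⟩ := h
  obtain ⟨j, k, l, hjk, hjl, hkl, hj, hk, hl⟩ := C.three i
  have hK : ∀ x ∈ C.hull (C.zeros (C.e i)), lor x.1 f = 0 := by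
    intro x hx
    rw [← C.face_eq_hull, h3] at hx
    exact hx.2
  have a := C.zeros_of_hull_subset h2 hK hjk hj hk
  have b := C.zeros_of_hull_subset h2 hK hjl hj hl
  exact C.eq_of_three hjk hjl hkl (C.e_unit i) h1 (C.lor_e_nonpos i) h2 hj hk hl a.1 a.2 b.2

lemma face_injective : Function.Injective C.face := by
  intro i i' h
  have := C.isOuterNormal_e i
  rw [h] at this
  exact C.e_injective (C.eq_e_of_isOuterNormal this)

lemma finrank_spanOf_face (i : I) : Module.finrank ℝ (spanOf (C.face i)) = 3 := by
  apply le_antisymm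
  · have hle : spanOf (C.face i) ≤ LinearMap.ker (lorLin (C.e i)) := by
      rw [Submodule.span_le]
      rintro _ ⟨x, hx, rfl⟩
      exact hx.2
    have hne : LinearMap.ker (lorLin (C.e i)) ≠ ⊤ := by
      intro h
      have : C.e i ∈ LinearMap.ker (lorLin (C.e i)) := by rw [h]; trivial
      have h2 : lor (C.e i) (C.e i) = 0 := this
      have := C.e_unit i
      linarith
    have h1 := Submodule.finrank_lt hne
    have h2 := Submodule.finrank_mono hle
    rw [Module.finrank_fin_fun] at h1
    omega
  · obtain ⟨j, k, l, hjk, hjl, hkl, hj, hk, hl⟩ := C.three i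
    rw [C.face_eq_hull]
    exact C.three_le_finrank_spanOf_hull hjk hjl hkl hj hk hl

lemma pair_cone (j k : J) (i : I) : lor (C.w j + C.w k) (C.e i) ≤ 0 := by
  rw [lor_add_left]; linarith [C.w_le j i, C.w_le k i]

/-- A two-dimensional face contains three generators. Their sum lies on the supporting plane, so by
`exists_wall` some wall contains it, hence contains all three generators and coincides with that
plane. -/
lemma isFace_two_iff {F : Set H3} : IsFace C.poly 2 F ↔ ∃ i, C.face i = F := by
  constructor
  · rintro ⟨⟨e, h1, h2, rfl⟩, hk⟩
    rw [C.support_eq_hull h2] at hk ⊢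
    have hcard : 2 < (C.zeros e).ncard := by
      have := C.finrank_spanOf_hull_le (C.zeros e)
      unfold spanOf at this
      omega
    obtain ⟨j, k, l, hj, hk, hl, hjk, hjl, hkl⟩ := (Set.two_lt_ncard_iff (Set.toFinite _)).1 hcard
    replace hj : lor (C.w j) e = 0 := hj
    replace hk : lor (C.w k) e = 0 := hk
    replace hl : lor (C.w l) e = 0 := hl
    obtain ⟨i, hi, -⟩ := C.exists_wall h2 (x := C.w j + C.w k + C.w l) (y := e)
      (fun i => by rw [lor_add_left]; linarith [C.pair_cone j k i, C.w_le l i])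
      (by rw [lor_add_left, lor_add_left, hj, hk, hl]; norm_num) (by linarith)
    rw [lor_add_left, lor_add_left] at hi
    have aj := C.w_le j i
    have ak := C.w_le k i
    have al := C.w_le l i
    have := C.eq_of_three hjk hjl hkl (C.e_unit i) h1 (C.lor_e_nonpos i) h2 (by linarith)
      (by linarith) (by linarith) hj hk hl
    exact ⟨i, by rw [C.face_eq_hull, this]⟩
  · rintro ⟨i, rfl⟩
    exact ⟨⟨_, C.isOuterNormal_e i⟩, C.finrank_spanOf_face i⟩

lemma faces_poly : faces C.poly = Set.range C.face := by
  ext F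
  exact C.isFace_two_iff

/-! ### Edges and adjacency -/

/-- Walls with two common generators enclose the angle `π / 3`. -/
lemma lor_eq_of_common {i i' : I} (hi : i ≠ i') {j k : J} (h : j ≠ k)
    (h1 : lor (C.w j) (C.e i) = 0) (h2 : lor (C.w k) (C.e i) = 0)
    (h3 : lor (C.w j) (C.e i') = 0) (h4 : lor (C.w k) (C.e i') = 0) :
    lor (C.e i) (C.e i') = -1 / 2 := by
  refine ((C.walls i i' hi).resolve_left fun hle => ?_).1
  have ht := C.lor_pair_neg h one_pos
  have hn : lor (-C.e i') (-C.e i') = 1 := by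
    rw [lor_neg_right, lor_comm, lor_neg_right, C.e_unit, neg_neg]
  -- The alternative `lor (e i) (e i') ≤ -1` would make the normals opposite, since both are
  -- orthogonal to a timelike vector.
  have heq := eq_of_orthogonal_of_one_le ht (C.e_unit i) hn
    (by rw [lor_add_left, lor_smul_left, h1, h2]; norm_num)
    (by rw [lor_neg_right, lor_add_left, lor_smul_left, h3, h4]; norm_num)
    (by rw [lor_neg_right]; linarith)
  have a := C.center_lt i
  have b := C.center_lt i'
  rw [heq, lor_neg_right] at a
  linarith

/-- Three walls have at most one common generator. -/
lemma not_common_three {i i' i'' : I} (h1 : i ≠ i') (h2 : i ≠ i'') (h3 : i' ≠ i'') {j k : J}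
    (h : j ≠ k) (hj : lor (C.w j) (C.e i) = 0) (hk : lor (C.w k) (C.e i) = 0)
    (hj' : lor (C.w j) (C.e i') = 0) (hk' : lor (C.w k) (C.e i') = 0)
    (hj'' : lor (C.w j) (C.e i'') = 0) (hk'' : lor (C.w k) (C.e i'') = 0) : False := by
  have a := C.lor_eq_of_common h1 h hj hk hj' hk'
  have b := C.lor_eq_of_common h2 h hj hk hj'' hk''
  have c := C.lor_eq_of_common h3 h hj' hk' hj'' hk''
  have ht := C.lor_pair_neg h one_pos
  -- Three unit vectors with pairwise products `-1/2` have a sum of norm `3 - 3 = 0`, which is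
  -- orthogonal to a timelike vector and so vanishes; but each of them pairs negatively with the
  -- centre.
  have hs : C.e i + C.e i' + C.e i'' = 0 := by
    refine (lor_self_nonneg_of_orthogonal ht ?_).2 ?_
    · rw [lor_comm]
      simp only [lor_add_left, lor_add_right, lor_smul_left, hj, hk, hj', hk', hj'', hk'']
      norm_num
    · simp only [lor_add_left, lor_add_right, C.e_unit, a, b, c, lor_comm (C.e i') (C.e i),
        lor_comm (C.e i'') (C.e i), lor_comm (C.e i'') (C.e i')]
      norm_num
  have h0 : lor C.center (C.e i + C.e i' + C.e i'') = 0 := by rw [hs, lor_zero_right]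
  rw [lor_add_right, lor_add_right] at h0
  linarith [C.center_lt i, C.center_lt i', C.center_lt i'']

lemma isFace_one_inter {i i' : I} (h : lor (C.e i) (C.e i') = -1 / 2) :
    IsFace C.poly 1 (C.face i ∩ C.face i') := by
  have hne : i ≠ i' := by
    rintro rfl
    have := C.e_unit i
    linarith
  refine ⟨⟨C.e i + C.e i', ?_, fun x hx => ?_, C.face_inter i i'⟩, ?_⟩
  · rw [lor_add_left, lor_add_right, lor_add_right, C.e_unit, C.e_unit, lor_comm (C.e i'), h]
    norm_num
  · rw [lor_add_right]
    linarith [hx i, hx i']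
  · rw [C.face_inter_eq_hull]
    obtain ⟨-, j, k, hjk, a, b, c, d⟩ := (C.walls i i' hne).resolve_left (by rw [h]; norm_num)
    apply le_antisymm
    · refine (C.finrank_spanOf_hull_le _).trans ?_
      by_contra hc
      push Not at hc
      obtain ⟨p, q, r, hp, hq, hr, hpq, hpr, hqr⟩ :=
        (Set.two_lt_ncard_iff (Set.toFinite _)).1 hc
      have := C.eq_of_three hpq hpr hqr (C.e_unit i) (C.e_unit i') (C.lor_e_nonpos i)
        (C.lor_e_nonpos i') hp.1 hq.1 hr.1 hp.2 hq.2 hr.2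
      exact hne (C.e_injective this.symm)
    · exact C.two_le_finrank_spanOf_hull hjk ⟨a, c⟩ ⟨b, d⟩

/-- An edge in a face is the intersection with a neighbouring face. -/
lemma exists_of_isFace_one {E : Set H3} (hE : IsFace C.poly 1 E) {i : I} (hi : E ⊆ C.face i) :
    ∃ i', lor (C.e i) (C.e i') = -1 / 2 ∧ E = C.face i ∩ C.face i' := by
  obtain ⟨⟨e, h1, h2, rfl⟩, hr⟩ := hE
  have hEi : ∀ x ∈ C.hull (C.zeros e), x ∈ C.face i := by rwa [C.support_eq_hull h2] at hi
  rw [C.support_eq_hull h2] at hr ⊢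
  have hcard : 1 < (C.zeros e).ncard := by
    have := C.finrank_spanOf_hull_le (C.zeros e)
    unfold spanOf at this
    omega
  obtain ⟨j, k, hj, hk, hjk⟩ := (Set.one_lt_ncard_iff (Set.toFinite _)).1 hcard
  have hmax : ∀ l ∈ C.zeros e, l = j ∨ l = k := by
    intro l hl
    by_contra hc
    push Not at hc
    have := C.three_le_finrank_spanOf_hull hjk hc.1.symm hc.2.symm hj hk hl
    unfold spanOf at this
    omega
  obtain ⟨hij, hik⟩ := C.zeros_of_hull_subset (C.lor_e_nonpos i) (fun x hx => (hEi x hx).2)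
    hjk hj hk
  have ht : lor (C.w j + C.w k) (C.w j + C.w k) < 0 := by
    simpa using C.lor_pair_neg hjk one_pos
  have hte : lor (C.w j + C.w k) e = 0 := by
    rw [lor_add_left, show lor (C.w j) e = 0 from hj, show lor (C.w k) e = 0 from hk, add_zero]
  have hti : lor (C.w j + C.w k) (C.e i) = 0 := by rw [lor_add_left, hij, hik, add_zero]
  -- Otherwise `e = e i`, and the edge would be the whole face, of rank 3.
  have hlt : lor e (C.e i) < 1 := by
    by_contra hc
    push Not at hc
    have := eq_of_orthogonal_of_one_le ht h1 (C.e_unit i) hte hti hc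
    rw [this, ← C.face_eq_hull] at hr
    have h3 := C.finrank_spanOf_face i
    unfold spanOf at h3
    omega
  -- The direction `e - e i` leaves the half-space of `e` but not that of `e i`, so the wall crossed
  -- at the sum of the two generators is a different one.
  obtain ⟨i', hi', hpos⟩ := C.exists_wall h2 (y := e - C.e i) (C.pair_cone j k) hte
    (by rw [lor_sub_left, h1, lor_comm]; linarith)
  have hne : i ≠ i' := by
    rintro rfl
    rw [lor_sub_left, C.e_unit] at hpos
    linarith
  rw [lor_add_left] at hi'
  have aj := C.w_le j i'
  have ak := C.w_le k i'
  have hj' : lor (C.w j) (C.e i') = 0 := by linarith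
  have hk' : lor (C.w k) (C.e i') = 0 := by linarith
  refine ⟨i', C.lor_eq_of_common hne hjk hij hik hj' hk', ?_⟩
  rw [C.face_inter_eq_hull]
  congr 1
  ext l
  constructor
  · intro hl
    rcases hmax l hl with rfl | rfl
    · exact ⟨hij, hj'⟩
    · exact ⟨hik, hk'⟩
  · rintro ⟨hl, hl'⟩
    by_cases hlj : l = j
    · rw [hlj]; exact hj
    by_cases hlk : l = k
    · rw [hlk]; exact hk
    have := C.eq_of_three hjk (Ne.symm hlj) (Ne.symm hlk) (C.e_unit i) (C.e_unit i')
      (C.lor_e_nonpos i) (C.lor_e_nonpos i') hij hik hl hj' hk' hl'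
    exact absurd (C.e_injective this.symm) hne

/-- Two neighbours along the same edge would give three walls with two common generators. -/
lemma face_inter_injOn (i : I) :
    Set.InjOn (fun i' => C.face i ∩ C.face i') {i' | lor (C.e i) (C.e i') = -1 / 2} := by
  intro i₁ (h₁ : _ = _) i₂ (h₂ : _ = _) heq
  have ne : ∀ {i'}, lor (C.e i) (C.e i') = -1 / 2 → i ≠ i' := by
    rintro i' h rfl
    have := C.e_unit i
    linarith
  by_contra hne
  obtain ⟨-, j, k, hjk, a, b, c, d⟩ :=
    (C.walls i i₁ (ne h₁)).resolve_left (by rw [h₁]; norm_num)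
  dsimp only at heq
  have hK : ∀ x ∈ C.hull (C.zeros (C.e i) ∩ C.zeros (C.e i₁)), lor x.1 (C.e i₂) = 0 := by
    intro x hx
    rw [← C.face_inter_eq_hull, heq] at hx
    exact hx.2.2
  obtain ⟨h3, h4⟩ := C.zeros_of_hull_subset (C.lor_e_nonpos i₂) hK hjk ⟨a, c⟩ ⟨b, d⟩
  exact C.not_common_three (ne h₁) (ne h₂) hne hjk a b c d h3 h4

lemma adjacent_iff {i i' : I} :
    Adjacent C.poly (C.face i) (C.face i') ↔ lor (C.e i) (C.e i') = -1 / 2 := by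
  constructor
  · rintro ⟨-, -, hne, hE⟩
    have hne' : i ≠ i' := fun h => hne (by rw [h])
    obtain ⟨⟨e, h1, h2, h3⟩, hr⟩ := hE
    rw [C.face_inter_eq_hull] at hr
    have hcard : 1 < (C.zeros (C.e i) ∩ C.zeros (C.e i')).ncard := by
      have := C.finrank_spanOf_hull_le (C.zeros (C.e i) ∩ C.zeros (C.e i'))
      unfold spanOf at this
      omega
    obtain ⟨j, k, hj, hk, hjk⟩ := (Set.one_lt_ncard_iff (Set.toFinite _)).1 hcard
    exact C.lor_eq_of_common hne' hjk hj.1 hk.1 hj.2 hk.2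
  · intro h
    refine ⟨C.isFace_two_iff.2 ⟨i, rfl⟩, C.isFace_two_iff.2 ⟨i', rfl⟩, fun heq => ?_,
      C.isFace_one_inter h⟩
    have := C.face_injective heq
    subst this
    have := C.e_unit i
    linarith

lemma isGon_iff {i : I} {k : ℕ} :
    IsGon C.poly k (C.face i) ↔ {i' | lor (C.e i) (C.e i') = -1 / 2}.encard = k := by
  have : {E | IsFace C.poly 1 E ∧ E ⊆ C.face i} =
      (fun i' => C.face i ∩ C.face i') '' {i' | lor (C.e i) (C.e i') = -1 / 2} := by
    ext E
    constructor
    · rintro ⟨hE, hi⟩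
      obtain ⟨i', h, rfl⟩ := C.exists_of_isFace_one hE hi
      exact ⟨i', h, rfl⟩
    · rintro ⟨i', h, rfl⟩
      exact ⟨C.isFace_one_inter h, Set.inter_subset_left⟩
  unfold IsGon
  rw [this, (C.face_inter_injOn i).encard_image]
  exact and_iff_right (C.isFace_two_iff.2 ⟨i, rfl⟩)

/-- At most one generator spans no point of `H3`, and two generators already give rank 2; rank 1
never occurs. -/
lemma not_isFace_zero (F : Set H3) : ¬ IsFace C.poly 0 F := by
  rintro ⟨⟨e, h1, h2, rfl⟩, hr⟩
  rw [C.support_eq_hull h2] at hr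
  by_cases h : (C.zeros e).Subsingleton
  · rw [C.hull_eq_empty h, Set.image_empty, Submodule.span_empty, finrank_bot] at hr
    omega
  · rw [Set.not_subsingleton_iff] at h
    obtain ⟨j, hj, k, hk, hjk⟩ := h
    have := C.two_le_finrank_spanOf_hull hjk hj hk
    unfold spanOf at this
    omega

lemma interior_nonempty : (interior C.poly).Nonempty := by
  refine ⟨toH3 C.center C.center_neg C.center_pos, ?_⟩
  rw [mem_interior]
  refine ⟨⋂ i, {x : H3 | lor x.1 (C.e i) < 0}, ?_, ?_, ?_⟩
  · intro x hx i
    exact le_of_lt (Set.mem_iInter.1 hx i)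
  · refine isOpen_iInter_of_finite fun i => ?_
    have : Continuous fun x : H3 => lor x.1 (C.e i) :=
      (continuous_lor_left _).comp continuous_subtype_val
    exact isOpen_lt this continuous_const
  · refine Set.mem_iInter.2 fun i => ?_
    obtain ⟨c, hc, hx⟩ := exists_toH3_eq _ C.center_neg C.center_pos
    change lor (toH3 _ _ _).1 _ < 0
    rw [hx, lor_smul_left]
    exact mul_neg_of_pos_of_neg hc (C.center_lt i)

end IdealCone

/-! ### Convex combinations of points of the unit sphere -/

section Sphere

variable {E : Type*} [NormedAddCommGroup E] [InnerProductSpace ℝ E] {J : Type} [Fintype J]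
  {p : J → E} {c : J → ℝ}

/-- The variance identity for the weights `c`: expand `‖y - p k‖ ^ 2` and average. -/
lemma one_sub_norm_sq_eq_sum (hp : ∀ j, ‖p j‖ = 1) (hs : ∑ j, c j = 1) :
    1 - ‖∑ j, c j • p j‖ ^ 2 = ∑ k, c k * ‖∑ j, c j • p j - p k‖ ^ 2 := by
  set y := ∑ j, c j • p j with hy
  have h1 : ∀ k, c k * ‖y - p k‖ ^ 2 = c k * ‖y‖ ^ 2 - 2 * inner ℝ y (c k • p k) + c k := by
    intro k
    rw [norm_sub_sq_real, hp, inner_smul_right]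
    ring
  rw [Finset.sum_congr rfl fun k _ => h1 k, Finset.sum_add_distrib, Finset.sum_sub_distrib,
    ← Finset.mul_sum, ← inner_sum, ← hy, real_inner_self_eq_norm_sq, ← Finset.sum_mul, hs]
  ring

lemma exists_pos_le_norm_sub {E : Type*} [NormedAddCommGroup E] {p : J → E} (hinj : Function.Injective p) :
    ∃ δ : ℝ, 0 < δ ∧ ∀ j k, j ≠ k → δ ≤ ‖p j - p k‖ := by
  have hev : ∀ᶠ δ : ℝ in nhdsWithin 0 (Set.Ioi 0), ∀ j k, j ≠ k → δ ≤ ‖p j - p k‖ := by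
    rw [Filter.eventually_all]
    intro j
    rw [Filter.eventually_all]
    intro k
    by_cases h : j = k
    · simp [h]
    · have h0 : 0 < ‖p j - p k‖ := norm_pos_iff.2 (sub_ne_zero.2 (hinj.ne h))
      filter_upwards [nhdsWithin_le_nhds (Iio_mem_nhds h0)] with δ hδ _ using le_of_lt hδ
  obtain ⟨δ, h1, h2⟩ := (hev.and self_mem_nhdsWithin).exists
  exact ⟨δ, h2, h1⟩

/-- A polytope inscribed in the unit sphere leaves the sphere at a linear rate at its vertices. -/
lemma exists_mul_norm_sub_le (hp : ∀ j, ‖p j‖ = 1) {δ : ℝ} (hδ : 0 < δ)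
    (hδp : ∀ j k, j ≠ k → δ ≤ ‖p j - p k‖) (hc : ∀ j, 0 ≤ c j) (hs : ∑ j, c j = 1) :
    ∃ j, δ ^ 2 / 8 * ‖∑ j, c j • p j - p j‖ ≤ 1 - ‖∑ j, c j • p j‖ ^ 2 := by
  classical
  have hne : Nonempty J := by
    by_contra h
    rw [not_nonempty_iff] at h
    simp at hs
  rw [one_sub_norm_sq_eq_sum hp hs]
  set y := ∑ j, c j • p j with hy
  obtain ⟨j, hj⟩ := Finite.exists_min fun j => ‖y - p j‖
  refine ⟨j, ?_⟩
  have far : ∀ k, k ≠ j → δ / 2 ≤ ‖y - p k‖ := by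
    intro k hk
    have h1 := hδp k j hk
    have h2 : ‖p k - p j‖ ≤ ‖y - p j‖ + ‖y - p k‖ := by
      have : p k - p j = (y - p j) - (y - p k) := by abel
      rw [this]
      exact norm_sub_le _ _
    have h3 := hj k
    linarith
  -- The distance to the nearest vertex is at most twice the total weight of the others. Each of
  -- these lies at distance at least `δ / 2`, so it contributes at least its weight times `δ ^ 2 /
  -- 4` to the variance; together this gives `δ ^ 2 / 8`.
  have near : ‖y - p j‖ ≤ ∑ k, c k * (if k = j then 0 else 2) := by
    have h1 : y - p j = ∑ k, c k • (p k - p j) := by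
      simp_rw [smul_sub]
      rw [Finset.sum_sub_distrib, ← Finset.sum_smul, hs, one_smul]
    rw [h1]
    refine (norm_sum_le _ _).trans (Finset.sum_le_sum fun k _ => ?_)
    rw [norm_smul, Real.norm_of_nonneg (hc k)]
    refine mul_le_mul_of_nonneg_left ?_ (hc k)
    split_ifs with h
    · simp [h]
    · refine (norm_sub_le _ _).trans ?_
      rw [hp, hp]
      norm_num
  calc δ ^ 2 / 8 * ‖y - p j‖ ≤ δ ^ 2 / 8 * ∑ k, c k * (if k = j then 0 else 2) := by gcongr
    _ = ∑ k, δ ^ 2 / 8 * (c k * (if k = j then 0 else 2)) := Finset.mul_sum _ _ _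
    _ ≤ _ := by
      refine Finset.sum_le_sum fun k _ => ?_
      split_ifs with h
      · have := hc k
        simp only [mul_zero]
        positivity
      · have h1 := far k h
        have h2 : (δ / 2) ^ 2 ≤ ‖y - p k‖ ^ 2 := by gcongr
        have := mul_le_mul_of_nonneg_left h2 (hc k)
        linarith

end Sphere

/-- The function `‖y‖⁻²`, cut off at radius 3. -/
def cutoff (y : EuclideanSpace ℝ (Fin 3)) : ENNReal :=
  (Metric.ball 0 3).indicator (fun y => ENNReal.ofReal (‖y‖ ^ 2)⁻¹) y

lemma measurable_cutoff : Measurable cutoff := by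
  unfold cutoff
  exact Measurable.indicator (by fun_prop) measurableSet_ball

/-- In polar coordinates in dimension 3 the weight `r ^ 2` cancels the singularity. -/
lemma lintegral_cutoff_lt_top : ∫⁻ y, cutoff y < ⊤ := by
  have h : IntegrableOn (fun y : EuclideanSpace ℝ (Fin 3) => (‖y‖ ^ 2)⁻¹) (Metric.ball 0 3) := by
    rw [integrableOn_fun_norm_addHaar volume (f := fun r : ℝ => (r ^ 2)⁻¹)]
    have : IntegrableOn (fun _ : ℝ => (1 : ℝ)) (Set.Ioo 0 3) := by simp
    refine this.congr_fun (fun r hr => ?_) measurableSet_Ioo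
    have hr0 : r ≠ 0 := hr.1.ne'
    simp [hr0]
  have h2 := h.lintegral_lt_top
  have h3 : ∫⁻ y, cutoff y =
      ∫⁻ y in Metric.ball (0 : EuclideanSpace ℝ (Fin 3)) 3, ENNReal.ofReal (‖y‖ ^ 2)⁻¹ := by
    rw [← lintegral_indicator measurableSet_ball]
    rfl
  rwa [h3]

/-! ### Ideal points, finite volume and dihedral angles -/

namespace IdealCone

variable {I J : Type} [Fintype J] (C : IdealCone I J)

/-- The ideal point of a generator. -/
def point (j : J) : EuclideanSpace ℝ (Fin 3) := radial (C.w j)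

lemma norm_point (j : J) : ‖C.point j‖ = 1 := by
  have h := norm_radial_sq (C.w_pos j).ne'
  rw [C.w_null, zero_div, add_zero] at h
  exact (pow_eq_one_iff_of_nonneg (norm_nonneg _) two_ne_zero).1 h

lemma point_injective : Function.Injective C.point := by
  intro j k h
  by_contra hne
  have hj := C.w_pos j
  have hk := C.w_pos k
  have h1 : ∀ i : Fin 3, C.w j i.succ / C.w j 0 = C.w k i.succ / C.w k 0 := fun i =>
    congrFun (congrArg (WithLp.ofLp) h) i
  have h2 : C.w j = (C.w j 0 / C.w k 0) • C.w k := by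
    ext i
    refine Fin.cases ?_ (fun i => ?_) i
    · simp [hk.ne']
    · have := h1 i
      simp only [Pi.smul_apply, smul_eq_mul]
      field_simp at this ⊢
      linarith
  have h3 := C.w_neg j k hne
  rw [h2, lor_smul_left, C.w_null, mul_zero] at h3
  exact lt_irrefl _ h3

/-- In the projective model, the points of a hull are convex combinations of ideal points. -/
lemma exists_weights {K : Set J} {x : H3} (hx : x ∈ C.hull K) :
    ∃ c : J → ℝ, (∀ j, 0 ≤ c j) ∧ (∀ j ∉ K, c j = 0) ∧ ∑ j, c j = 1 ∧
      klein x = ∑ j, c j • C.point j := by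
  obtain ⟨c, hc, hz, hxc⟩ := hx
  have hx0 := x.2.2
  refine ⟨fun j => c j * C.w j 0 / x.1 0, fun j => ?_, fun j hj => ?_, ?_, ?_⟩
  · have := hc j
    have := C.w_pos j
    positivity
  · simp [hz j hj]
  · rw [← Finset.sum_div, div_eq_one_iff_eq hx0.ne']
    have := congrFun hxc 0
    simpa using this.symm
  · ext i
    have h1 := congrFun hxc i.succ
    simp only [klein, point, radial]
    rw [h1]
    simp only [Finset.sum_apply, Pi.smul_apply, smul_eq_mul, Finset.sum_div, WithLp.ofLp_sum,
      WithLp.ofLp_smul]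
    refine Finset.sum_congr rfl fun j _ => ?_
    have := (C.w_pos j).ne'
    field_simp

/-- By compactness of the simplex a limit point is still a convex combination of ideal points. If it
has norm 1, the variance identity makes it equal to every ideal point of nonzero weight. Conversely
`w j + s • w k` tends to the ideal point of `w j` as `s` tends to 0. -/
lemma pointsAtInfinity_hull {K : Set J} (hK : K.Nontrivial) :
    pointsAtInfinity (C.hull K) = C.point '' K := by
  classical
  apply Set.Subset.antisymm
  · rintro y ⟨hy1, hy⟩
    have hsub : klein '' C.hull K ⊆ (fun c : J → ℝ => ∑ j, c j • C.point j) ''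
        (stdSimplex ℝ J ∩ {c | ∀ j ∉ K, c j = 0}) := by
      rintro _ ⟨x, hx, rfl⟩
      obtain ⟨c, hc, hz, hs, hk⟩ := C.exists_weights hx
      exact ⟨c, ⟨⟨hc, hs⟩, hz⟩, hk.symm⟩
    have hclosed : IsClosed {c : J → ℝ | ∀ j ∉ K, c j = 0} := by
      simp only [Set.ofPred_forall]
      exact isClosed_iInter fun j => isClosed_iInter fun _ =>
        isClosed_eq (continuous_apply j) continuous_const
    have hcomp : IsCompact ((fun c : J → ℝ => ∑ j, c j • C.point j) ''
        (stdSimplex ℝ J ∩ {c | ∀ j ∉ K, c j = 0})) :=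
      ((isCompact_stdSimplex ℝ J).inter_right hclosed).image (by fun_prop)
    obtain ⟨c, ⟨⟨hc, hs⟩, hz⟩, rfl⟩ := closure_minimal hsub hcomp.isClosed hy
    have hn := one_sub_norm_sq_eq_sum C.norm_point hs
    rw [mem_sphere_zero_iff_norm] at hy1
    dsimp only at hy1
    rw [hy1] at hn
    have hzero := (Finset.sum_eq_zero_iff_of_nonneg fun k _ =>
      mul_nonneg (hc k) (sq_nonneg _)).1 (show _ = (0 : ℝ) by rw [← hn]; norm_num)
    have : ∃ k, c k ≠ 0 := by
      by_contra h
      push Not at h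
      simp [h] at hs
    obtain ⟨k, hk⟩ := this
    have h1 := (mul_eq_zero.1 (hzero k (Finset.mem_univ k))).resolve_left hk
    refine ⟨k, by by_contra h; exact hk (hz k h), ?_⟩
    exact (sub_eq_zero.1 (norm_eq_zero.1 (pow_eq_zero_iff two_ne_zero |>.1 h1))).symm
  · rintro _ ⟨j, hj, rfl⟩
    refine ⟨by rw [mem_sphere_zero_iff_norm, C.norm_point], ?_⟩
    obtain ⟨k, hk, hkj⟩ := hK.exists_ne j
    have hcont : Filter.Tendsto (fun s : ℝ => radial (C.w j + s • C.w k))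
        (nhdsWithin 0 (Set.Ioi 0)) (nhds (C.point j)) := by
      have h0 : C.point j = radial (C.w j + (0 : ℝ) • C.w k) := by simp [point]
      rw [h0]
      refine Filter.Tendsto.mono_left ?_ nhdsWithin_le_nhds
      refine ContinuousAt.tendsto (f := fun s : ℝ => radial (C.w j + s • C.w k)) ?_
      unfold radial
      refine (PiLp.continuous_toLp 2 _).continuousAt.comp (continuousAt_pi.2 fun i => ?_)
      refine ContinuousAt.div (by fun_prop) (by fun_prop) ?_
      simpa using (C.w_pos j).ne'
    refine mem_closure_of_tendsto hcont ?_
    filter_upwards [self_mem_nhdsWithin] with s hs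
    refine ⟨_, C.pair_mem_hull hkj.symm hj hk hs, ?_⟩
    obtain ⟨c, hc, hx⟩ := exists_toH3_eq _ (C.lor_pair_neg hkj.symm hs) (C.pair_pos j k hs)
    rw [klein_eq_radial, hx, radial_smul hc.ne']

lemma poly_eq_hull : C.poly = C.hull Set.univ := by
  refine Set.Subset.antisymm (fun x hx => ?_) (C.hull_subset_poly _)
  obtain ⟨c, hc, h⟩ := C.dual x.1 hx
  exact ⟨c, hc, fun j hj => absurd (Set.mem_univ j) hj, h⟩

lemma idealVertices_poly [Nontrivial J] : idealVertices C.poly = Set.range C.point := by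
  rw [idealVertices, poly_eq_hull, C.pointsAtInfinity_hull Set.nontrivial_univ, Set.image_univ]

lemma point_mem_pointsAtInfinity_face [Nontrivial J] (i : I) (j : J) :
    C.point j ∈ pointsAtInfinity (C.face i) ↔ lor (C.w j) (C.e i) = 0 := by
  obtain ⟨p, q, -, hpq, -, -, hp, hq, -⟩ := C.three i
  rw [C.face_eq_hull, C.pointsAtInfinity_hull ⟨p, hp, q, hq, hpq⟩,
    C.point_injective.mem_set_image]
  rfl

/-- The linear rate bounds the density by a constant times the inverse square distance to some
vertex, hence by the sum of these functions over all vertices, each integrable in dimension 3. -/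
lemma hvol_poly_lt_top : hvol C.poly < ⊤ := by
  obtain ⟨δ, hδ, hδp⟩ := exists_pos_le_norm_sub C.point_injective
  have hbound : ∀ y ∈ klein '' C.poly, ENNReal.ofReal (1 / (1 - ‖y‖ ^ 2) ^ 2) ≤
      ∑ j, ENNReal.ofReal (((δ ^ 2 / 8) ^ 2)⁻¹) * cutoff (y - C.point j) := by
    rintro _ ⟨x, hx, rfl⟩
    have hx1 := norm_klein_lt_one x
    rw [C.poly_eq_hull] at hx
    obtain ⟨c, hc, -, hs, hk⟩ := C.exists_weights hx
    obtain ⟨j, hj⟩ := exists_mul_norm_sub_le C.norm_point hδ hδp hc hs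
    rw [← hk] at hj
    refine le_trans ?_ (Finset.single_le_sum (f := fun j =>
      ENNReal.ofReal (((δ ^ 2 / 8) ^ 2)⁻¹) * cutoff (klein x - C.point j))
      (fun _ _ => zero_le) (Finset.mem_univ j))
    have hpos : 0 < ‖klein x - C.point j‖ := by
      rw [norm_pos_iff, sub_ne_zero]
      intro h
      rw [h, C.norm_point] at hx1
      exact lt_irrefl _ hx1
    have hball : klein x - C.point j ∈ Metric.ball (0 : EuclideanSpace ℝ (Fin 3)) 3 := by
      rw [mem_ball_zero_iff]
      have := norm_sub_le (klein x) (C.point j)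
      rw [C.norm_point] at this
      linarith
    rw [cutoff, Set.indicator_of_mem hball, ← ENNReal.ofReal_mul (by positivity)]
    refine ENNReal.ofReal_le_ofReal ?_
    rw [← mul_inv, ← mul_pow, one_div]
    gcongr
  have hmeas : Measurable fun y => ∑ j, ENNReal.ofReal (((δ ^ 2 / 8) ^ 2)⁻¹) *
      cutoff (y - C.point j) := by
    refine Finset.measurable_fun_sum _ fun j _ => Measurable.const_mul ?_ _
    exact measurable_cutoff.comp (measurable_id.sub_const _)
  refine (setLIntegral_mono hmeas hbound).trans_lt ((setLIntegral_le_lintegral _ _).trans_lt ?_)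
  have hmeas' : ∀ j, Measurable fun y => cutoff (y - C.point j) := fun j =>
    measurable_cutoff.comp (measurable_id.sub_const _)
  rw [lintegral_finsetSum _ fun j _ => (hmeas' j).const_mul _]
  refine ENNReal.sum_lt_top.2 fun j _ => ?_
  rw [lintegral_const_mul _ (hmeas' j),
    lintegral_sub_right_eq_self (fun y => cutoff y)]
  exact ENNReal.mul_lt_top ENNReal.ofReal_lt_top lintegral_cutoff_lt_top

variable [Nontrivial J] [Finite I]

lemma isPolyhedron : IsPolyhedron C.poly := by
  refine ⟨⟨Set.range C.e, Set.finite_range _, ?_, ?_⟩, C.interior_nonempty, C.hvol_poly_lt_top⟩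
  · rintro _ ⟨i, rfl⟩
    exact C.e_unit i
  · ext x
    exact (Set.forall_mem_range (p := fun e => lor x.1 e ≤ 0)).symm

lemma isIdealPolyhedron : IsIdealPolyhedron C.poly :=
  ⟨C.isPolyhedron, fun x => C.not_isFace_zero {x}⟩

lemma isEquiangular : IsEquiangular (Real.pi / 3) C.poly := by
  refine ⟨C.isPolyhedron, fun F G hFG e f he hf => ?_⟩
  obtain ⟨i, rfl⟩ := C.isFace_two_iff.1 hFG.1
  obtain ⟨i', rfl⟩ := C.isFace_two_iff.1 hFG.2.1
  rw [C.eq_e_of_isOuterNormal he, C.eq_e_of_isOuterNormal hf, C.adjacent_iff.1 hFG,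
    show (-1 / 2 : ℝ) = -(1 / 2) by norm_num, Real.arccos_neg, ← Real.cos_pi_div_three,
    Real.arccos_cos (by positivity) (by linarith [Real.pi_pos])]
  ring

end IdealCone

/-! ### Coordinates adapted to an ideal point -/

/-- The vector of `ℝ^{1,3}` with barycentric coordinates `z` with respect to three planes through a
common ideal point and height `v`. -/
def vec (n : ℝ) (z : Fin 3 → ℝ) (v : ℝ) : Fin 4 → ℝ :=
  ![((z 0 + z 1 + z 2) / (3 * n) + (2 / 3 * v - 2 * n * ((z 0 + z 1 + z 2) / 3))) / 2,
    (z 0 + z 1 + z 2) / 3 - z 0, (z 2 - z 1) / Real.sqrt 3,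
    ((2 / 3 * v - 2 * n * ((z 0 + z 1 + z 2) / 3)) - (z 0 + z 1 + z 2) / (3 * n)) / 2]

/-- The Euclidean dot product of barycentric coordinates. -/
def dot (z z' : Fin 3 → ℝ) : ℝ := z 0 * z' 0 + z 1 * z' 1 + z 2 * z' 2

/-- Here `u` is a homogenizing coordinate. For `u = 1` the norm is `2/3 (|z|² - v)`, so the
light-like vectors are the points `z` of the boundary plane with `v = |z|²`, and timelike ones with
`v > |z|²` lie above `z` in the upper half-space. The vector with `z = 0`, `u = 0`, `v = 1` is the
point at infinity. -/
lemma lor_vec {n : ℝ} (hn : n ≠ 0) {z z' : Fin 3 → ℝ} {u u' : ℝ} (v v' : ℝ)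
    (hz : z 0 + z 1 + z 2 = 3 * n * u) (hz' : z' 0 + z' 1 + z' 2 = 3 * n * u') :
    lor (vec n z v) (vec n z' v') = 2 / 3 * (dot z z' - (u * v' + u' * v) / 2) := by
  have h3 : Real.sqrt 3 * Real.sqrt 3 = 3 := Real.mul_self_sqrt (by norm_num)
  have hs : (z 2 - z 1) / Real.sqrt 3 * ((z' 2 - z' 1) / Real.sqrt 3) =
      (z 2 - z 1) * (z' 2 - z' 1) / 3 := by rw [div_mul_div_comm, h3]
  have e : 3 * n * u / (3 * n) = u := by field_simp
  have e' : 3 * n * u' / (3 * n) = u' := by field_simp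
  simp only [lor, vec, dot, Matrix.cons_val_zero, Matrix.cons_val_one, Matrix.cons_val]
  rw [hs, hz, hz', e, e']
  have a : z 2 = 3 * n * u - z 0 - z 1 := by linarith
  have a' : z' 2 = 3 * n * u' - z' 0 - z' 1 := by linarith
  rw [a, a']
  ring

lemma vec_add (n : ℝ) (z z' : Fin 3 → ℝ) (v v' : ℝ) :
    vec n (z + z') (v + v') = vec n z v + vec n z' v' := by
  ext i
  fin_cases i <;> simp [vec] <;> ring

lemma vec_smul (n c : ℝ) (z : Fin 3 → ℝ) (v : ℝ) : vec n (c • z) (c * v) = c • vec n z v := by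
  ext i
  fin_cases i <;> simp [vec] <;> ring

lemma exists_eq_vec {n : ℝ} (hn : n ≠ 0) (x : Fin 4 → ℝ) : ∃ z v, x = vec n z v := by
  have h3 : Real.sqrt 3 * Real.sqrt 3 = 3 := Real.mul_self_sqrt (by norm_num)
  have h0 : Real.sqrt 3 ≠ 0 := by positivity
  refine ⟨![n * (x 0 - x 3) - x 1, n * (x 0 - x 3) + (x 1 - Real.sqrt 3 * x 2) / 2,
    n * (x 0 - x 3) + (x 1 + Real.sqrt 3 * x 2) / 2],
    3 / 2 * (x 0 + x 3 + 2 * n ^ 2 * (x 0 - x 3)), ?_⟩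
  ext i
  fin_cases i <;> simp [vec] <;> field_simp <;> ring

/-! ### The triangular pattern -/

/-- The points of the triangular lattice in a triangle of side `k`. -/
abbrev Tri (k : ℕ) : Type := {f : Fin 3 → ℕ // f 0 + f 1 + f 2 = k}

instance (k : ℕ) : Finite (Tri k) := by
  refine Finite.of_injective (fun f : Tri k => fun i => (⟨f.1 i, ?_⟩ : Fin (k + 1))) ?_
  · have := f.2
    fin_cases i <;> simp <;> omega
  · intro f g h
    ext i
    simpa using congrFun h i

/-- Indices of the finite ideal vertices. The second kind has coordinate sum `m - 1`. -/
abbrev FinVert (m : ℕ) : Type := Tri (m + 1) ⊕ {f : Fin 3 → ℕ // f 0 + f 1 + f 2 + 1 = m}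

/-- Indices of the ideal vertices. -/
abbrev Vert (m : ℕ) : Type := Option (FinVert m)

/-- Indices of the faces. -/
abbrev Wall (m : ℕ) : Type := Fin 3 ⊕ Tri m

instance (m : ℕ) : Finite {f : Fin 3 → ℕ // f 0 + f 1 + f 2 + 1 = m} := by
  refine Finite.of_injective (fun f : {f : Fin 3 → ℕ // f 0 + f 1 + f 2 + 1 = m} =>
    (⟨f.1, by have := f.2; omega⟩ : Tri (m - 1))) fun f g h => ?_
  exact Subtype.ext (Subtype.mk.inj h)

variable {m : ℕ}

/-- Barycentric coordinates of a finite ideal vertex. -/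
def pos : FinVert m → Fin 3 → ℝ
  | .inl f => fun i => 3 * (f.1 i : ℝ)
  | .inr f => fun i => 3 * (f.1 i : ℝ) + 2

/-- Barycentric coordinates of the centre of a hemisphere. -/
def ctr (g : Tri m) : Fin 3 → ℝ := fun i => 3 * (g.1 i : ℝ) + 1

/-- The light-like vectors of the ideal vertices. -/
def vertVec : Vert m → Fin 4 → ℝ
  | none => vec (m + 1) 0 1
  | some j => vec (m + 1) (pos j) (dot (pos j) (pos j))

/-- The outer unit normals of the faces. -/
def wallVec : Wall m → Fin 4 → ℝ
  | .inl i => vec (m + 1) (fun k => 1 / 2 - if k = i then 3 / 2 else 0) (3 * (m + 1))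
  | .inr g => vec (m + 1) ((1 / 2 : ℝ) • ctr g) ((dot (ctr g) (ctr g) - 6) / 2)

lemma side_ne_zero (m : ℕ) : (m : ℝ) + 1 ≠ 0 := by positivity

lemma sum_pos (j : FinVert m) : pos j 0 + pos j 1 + pos j 2 = 3 * ((m : ℝ) + 1) * 1 := by
  rcases j with f | f
  · have h : (f.1 0 : ℝ) + f.1 1 + f.1 2 = m + 1 := by exact_mod_cast f.2
    simp only [pos]; linarith
  · have h : (f.1 0 : ℝ) + f.1 1 + f.1 2 + 1 = m := by exact_mod_cast f.2
    simp only [pos]; linarith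

lemma sum_ctr (g : Tri m) : ctr g 0 + ctr g 1 + ctr g 2 = 3 * ((m : ℝ) + 1) := by
  have h : (g.1 0 : ℝ) + g.1 1 + g.1 2 = m := by exact_mod_cast g.2
  simp only [ctr]; linarith

lemma sum_half_ctr (g : Tri m) : ((1 / 2 : ℝ) • ctr g) 0 + ((1 / 2 : ℝ) • ctr g) 1 +
    ((1 / 2 : ℝ) • ctr g) 2 = 3 * ((m : ℝ) + 1) * (1 / 2) := by
  have h := sum_ctr g
  simp only [Pi.smul_apply, smul_eq_mul]; linarith

lemma sum_side (i : Fin 3) : (fun k => 1 / 2 - if k = i then (3 / 2 : ℝ) else 0) 0 +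
    (fun k => 1 / 2 - if k = i then (3 / 2 : ℝ) else 0) 1 +
    (fun k => 1 / 2 - if k = i then (3 / 2 : ℝ) else 0) 2 = 3 * ((m : ℝ) + 1) * 0 := by
  fin_cases i <;> simp <;> norm_num

lemma lor_vec_side {z : Fin 3 → ℝ} {u : ℝ} (v : ℝ) (hz : z 0 + z 1 + z 2 = 3 * ((m : ℝ) + 1) * u)
    (i : Fin 3) : lor (vec (m + 1) z v) (wallVec (m := m) (.inl i)) = -z i := by
  rw [wallVec, lor_vec (side_ne_zero m) _ _ hz (sum_side i)]
  have : 3 * ((m : ℝ) + 1) * u = z 0 + z 1 + z 2 := hz.symm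
  rw [show (u * (3 * ((m : ℝ) + 1)) + 0 * v) = z 0 + z 1 + z 2 by linarith]
  fin_cases i <;> simp [dot] <;> ring

lemma lor_vec_sphere {z : Fin 3 → ℝ} {u : ℝ} (v : ℝ)
    (hz : z 0 + z 1 + z 2 = 3 * ((m : ℝ) + 1) * u) (g : Tri m) :
    lor (vec (m + 1) z v) (wallVec (.inr g)) =
      (2 * dot z (ctr g) - u * (dot (ctr g) (ctr g) - 6) - v) / 6 := by
  rw [wallVec, lor_vec (side_ne_zero m) _ _ hz (sum_half_ctr g)]
  simp only [dot, Pi.smul_apply, smul_eq_mul]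
  ring

/-- The constant 6 is the squared radius of the hemispheres, and the numerator is minus the power of
the vertex with respect to the circle. -/
lemma lor_vert_sphere (j : FinVert m) (g : Tri m) :
    lor (vertVec (some j)) (wallVec (.inr g)) =
      (6 - ((pos j 0 - ctr g 0) ^ 2 + (pos j 1 - ctr g 1) ^ 2 + (pos j 2 - ctr g 2) ^ 2)) / 6 := by
  rw [vertVec, lor_vec_sphere _ (sum_pos j)]
  simp only [dot]
  ring

/-- Neighbouring centres have squared distance `3² + 3² = 18`, which gives `-1/2`. -/
lemma lor_sphere_sphere (g g' : Tri m) : lor (wallVec (.inr g)) (wallVec (.inr g')) =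
      1 - ((ctr g 0 - ctr g' 0) ^ 2 + (ctr g 1 - ctr g' 1) ^ 2 + (ctr g 2 - ctr g' 2) ^ 2) / 12 := by
  rw [wallVec, lor_vec_sphere _ (sum_half_ctr g)]
  simp only [dot, Pi.smul_apply, smul_eq_mul]
  ring

lemma lor_sphere_side (g : Tri m) (i : Fin 3) :
    lor (wallVec (.inr g)) (wallVec (m := m) (.inl i)) = -(3 * (g.1 i : ℝ) + 1) / 2 := by
  rw [wallVec.eq_2, lor_vec_side _ (sum_half_ctr g)]
  simp only [ctr, Pi.smul_apply, smul_eq_mul]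
  ring

lemma lor_side_side (i i' : Fin 3) :
    lor (wallVec (m := m) (.inl i)) (wallVec (m := m) (.inl i')) = if i = i' then 1 else -1 / 2 := by
  rw [wallVec, lor_vec_side _ (sum_side i)]
  split_ifs with h h' h'
  · norm_num
  · exact absurd h.symm h'
  · exact absurd h'.symm h
  · norm_num

lemma lor_infty_side (i : Fin 3) : lor (vertVec (m := m) none) (wallVec (m := m) (.inl i)) = 0 := by
  rw [vertVec, lor_vec_side (u := 0) _ (by simp)]
  simp

lemma lor_infty_sphere (g : Tri m) :
    lor (vertVec (m := m) none) (wallVec (.inr g)) = -1 / 6 := by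
  rw [vertVec, lor_vec_sphere (u := 0) _ (by simp)]
  simp [dot]

lemma lor_vert_side (j : FinVert m) (i : Fin 3) :
    lor (vertVec (some j)) (wallVec (m := m) (.inl i)) = -pos j i := by
  rw [vertVec, lor_vec_side _ (sum_pos j)]

lemma pos_nonneg (j : FinVert m) (i : Fin 3) : 0 ≤ pos j i := by
  rcases j with f | f <;> simp only [pos] <;> positivity

lemma pos_injective : Function.Injective (pos (m := m)) := by
  rintro (f | f) (g | g) h
  · congr 1
    ext i
    have h1 : 3 * (f.1 i : ℝ) = 3 * (g.1 i : ℝ) := congrFun h i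
    have h2 : 3 * f.1 i = 3 * g.1 i := by exact_mod_cast h1
    omega
  · have h1 : 3 * (f.1 0 : ℝ) = 3 * (g.1 0 : ℝ) + 2 := congrFun h 0
    have h2 : 3 * f.1 0 = 3 * g.1 0 + 2 := by exact_mod_cast h1
    omega
  · have h1 : 3 * (f.1 0 : ℝ) + 2 = 3 * (g.1 0 : ℝ) := congrFun h 0
    have h2 : 3 * f.1 0 + 2 = 3 * g.1 0 := by exact_mod_cast h1
    omega
  · congr 1
    ext i
    have h1 : 3 * (f.1 i : ℝ) + 2 = 3 * (g.1 i : ℝ) + 2 := congrFun h i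
    have h2 : 3 * f.1 i + 2 = 3 * g.1 i + 2 := by exact_mod_cast h1
    omega

lemma lor_vert_vert (j k : FinVert m) : lor (vertVec (some j)) (vertVec (some k)) =
    -((pos j 0 - pos k 0) ^ 2 + (pos j 1 - pos k 1) ^ 2 + (pos j 2 - pos k 2) ^ 2) / 3 := by
  rw [vertVec, vertVec, lor_vec (side_ne_zero m) _ _ (sum_pos j) (sum_pos k)]
  simp only [dot]
  ring

lemma lor_vert_infty (j : FinVert m) : lor (vertVec (some j)) (vertVec (m := m) none) = -1 / 3 := by
  rw [vertVec, vertVec, lor_vec (u' := 0) (side_ne_zero m) _ _ (sum_pos j) (by simp)]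
  simp only [dot, Pi.zero_apply]
  ring

lemma lor_infty_infty : lor (vertVec (m := m) none) (vertVec (m := m) none) = 0 := by
  rw [vertVec, lor_vec (u := 0) (u' := 0) (side_ne_zero m) _ _ (by simp) (by simp)]
  simp [dot]

lemma vertVec_null (j : Vert m) : lor (vertVec j) (vertVec j) = 0 := by
  rcases j with _ | j
  · exact lor_infty_infty
  · rw [lor_vert_vert]; ring

lemma vertVec_neg (j k : Vert m) (h : j ≠ k) : lor (vertVec j) (vertVec k) < 0 := by
  rcases j with _ | j <;> rcases k with _ | k
  · exact absurd rfl h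
  · rw [lor_comm, lor_vert_infty]; norm_num
  · rw [lor_vert_infty]; norm_num
  · rw [lor_vert_vert]
    have hne : ¬ (pos j 0 - pos k 0) ^ 2 + (pos j 1 - pos k 1) ^ 2 +
        (pos j 2 - pos k 2) ^ 2 ≤ 0 := by
      intro hle
      apply h
      congr 1
      apply pos_injective
      have a0 := sq_nonneg (pos j 0 - pos k 0)
      have a1 := sq_nonneg (pos j 1 - pos k 1)
      have a2 := sq_nonneg (pos j 2 - pos k 2)
      have b0 := sub_eq_zero.1 (pow_eq_zero_iff two_ne_zero |>.1
        (by linarith : (pos j 0 - pos k 0) ^ 2 = 0))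
      have b1 := sub_eq_zero.1 (pow_eq_zero_iff two_ne_zero |>.1
        (by linarith : (pos j 1 - pos k 1) ^ 2 = 0))
      have b2 := sub_eq_zero.1 (pow_eq_zero_iff two_ne_zero |>.1
        (by linarith : (pos j 2 - pos k 2) ^ 2 = 0))
      ext i
      fin_cases i <;> assumption
    push Not at hne
    linarith

lemma vertVec_pos (j : Vert m) : 0 < vertVec j 0 := by
  rcases j with _ | j
  · simp [vertVec, vec]
  · have h := sum_pos j
    have hn := side_ne_zero m
    simp only [vertVec, vec, Matrix.cons_val_zero, h]
    have e : 3 * ((m : ℝ) + 1) * 1 / (3 * (m + 1)) = 1 := by field_simp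
    rw [e]
    simp only [dot]
    nlinarith [sq_nonneg (pos j 0 - pos j 1), sq_nonneg (pos j 0 - pos j 2),
      sq_nonneg (pos j 1 - pos j 2)]

lemma wallVec_unit (i : Wall m) : lor (wallVec i) (wallVec i) = 1 := by
  rcases i with i | g
  · rw [lor_side_side, if_pos rfl]
  · rw [lor_sphere_sphere]; ring

/-- No vertex lies inside a hemisphere. The lattice differences sum to `±1`, so, since `h² ≥ |h|`
for integers, their squares sum to at least 1; this makes the squared distance to the centre at
least 6. -/
lemma vert_wall_nonpos (j : Vert m) (i : Wall m) : lor (vertVec j) (wallVec i) ≤ 0 := by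
  rcases j with _ | j <;> rcases i with i | g
  · rw [lor_infty_side]
  · rw [lor_infty_sphere]; norm_num
  · rw [lor_vert_side]; linarith [pos_nonneg j i]
  · rw [lor_vert_sphere]
    have key : ∀ h : ℤ, h ≤ h ^ 2 ∧ -h ≤ h ^ 2 := fun h =>
      ⟨Int.le_self_sq h, by simpa using Int.le_self_sq (-h)⟩
    rcases j with f | f
    · have hs : (f.1 0 - g.1 0 : ℤ) + (f.1 1 - g.1 1) + (f.1 2 - g.1 2) = 1 := by
        have h1 := f.2
        have h2 := g.2
        omega
      have hq : (1 : ℤ) ≤ (f.1 0 - g.1 0) ^ 2 + (f.1 1 - g.1 1) ^ 2 + (f.1 2 - g.1 2) ^ 2 := by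
        linarith [(key (f.1 0 - g.1 0)).1, (key (f.1 1 - g.1 1)).1, (key (f.1 2 - g.1 2)).1]
      have hs' : (f.1 0 - g.1 0 : ℝ) + (f.1 1 - g.1 1) + (f.1 2 - g.1 2) = 1 := by exact_mod_cast hs
      have hq' : (1 : ℝ) ≤ (f.1 0 - g.1 0) ^ 2 + (f.1 1 - g.1 1) ^ 2 + (f.1 2 - g.1 2) ^ 2 := by
        exact_mod_cast hq
      simp only [pos, ctr]
      linarith
    · have hs : (f.1 0 - g.1 0 : ℤ) + (f.1 1 - g.1 1) + (f.1 2 - g.1 2) = -1 := by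
        have h1 := f.2
        have h2 := g.2
        omega
      have hq : (1 : ℤ) ≤ (f.1 0 - g.1 0) ^ 2 + (f.1 1 - g.1 1) ^ 2 + (f.1 2 - g.1 2) ^ 2 := by
        linarith [(key (f.1 0 - g.1 0)).2, (key (f.1 1 - g.1 1)).2, (key (f.1 2 - g.1 2)).2]
      have hs' : (f.1 0 - g.1 0 : ℝ) + (f.1 1 - g.1 1) + (f.1 2 - g.1 2) = -1 := by
        exact_mod_cast hs
      have hq' : (1 : ℝ) ≤ (f.1 0 - g.1 0) ^ 2 + (f.1 1 - g.1 1) ^ 2 + (f.1 2 - g.1 2) ^ 2 := by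
        exact_mod_cast hq
      simp only [pos, ctr]
      linarith

/-! ### Incidences -/

/-- The vertex of the cell of `g` in the direction of the `k`-th corner. -/
def upVert (g : Tri m) (k : Fin 3) : FinVert m :=
  .inl ⟨g.1 + Pi.single k 1, by
    have := g.2
    fin_cases k <;> simp <;> omega⟩

lemma upVert_injective (g : Tri m) : Function.Injective (upVert g) := by
  intro k l h
  simp only [upVert, Sum.inl.injEq, Subtype.mk.injEq, add_right_inj] at h
  by_contra hne
  have := congrFun h k
  simp [hne] at this

lemma lor_upVert (g : Tri m) (k : Fin 3) :
    lor (vertVec (some (upVert g k))) (wallVec (.inr g)) = 0 := by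
  rw [lor_vert_sphere]
  fin_cases k <;> simp [upVert, pos, ctr] <;> ring

lemma lor_up_of_eq {f : Tri (m + 1)} {g : Tri m} {k : Fin 3} (h : f.1 = g.1 + Pi.single k 1) :
    lor (vertVec (some (.inl f))) (wallVec (.inr g)) = 0 := by
  have : (.inl f : FinVert m) = upVert g k := by
    simp only [upVert, Sum.inl.injEq]
    exact Subtype.ext h
  rw [this, lor_upVert]

lemma lor_down_of_eq {f : {f : Fin 3 → ℕ // f 0 + f 1 + f 2 + 1 = m}} {g : Tri m} {k : Fin 3}
    (h : g.1 = f.1 + Pi.single k 1) :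
    lor (vertVec (some (.inr f))) (wallVec (.inr g)) = 0 := by
  rw [lor_vert_sphere]
  simp only [pos, ctr, h, Pi.add_apply]
  fin_cases k <;> simp <;> ring

/-- The ideal vertex in the `k`-th corner of the triangle. -/
def corner (k : Fin 3) : FinVert m :=
  .inl ⟨Pi.single k (m + 1), by fin_cases k <;> simp⟩

lemma corner_injective : Function.Injective (corner (m := m)) := by
  intro k l h
  simp only [corner, Sum.inl.injEq, Subtype.mk.injEq] at h
  by_contra hne
  have := congrFun h k
  simp [hne] at this

lemma lor_corner_side {k i : Fin 3} (h : i ≠ k) :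
    lor (vertVec (m := m) (some (corner k))) (wallVec (m := m) (.inl i)) = 0 := by
  rw [lor_vert_side]
  simp [corner, pos, h]

lemma wall_three (i : Wall m) : ∃ j k l : Vert m, j ≠ k ∧ j ≠ l ∧ k ≠ l ∧
    lor (vertVec j) (wallVec i) = 0 ∧ lor (vertVec k) (wallVec i) = 0 ∧
    lor (vertVec l) (wallVec i) = 0 := by
  rcases i with i | g
  · refine ⟨none, some (corner (i + 1)), some (corner (i + 2)), by simp, by simp, ?_,
      lor_infty_side i, lor_corner_side ?_, lor_corner_side ?_⟩
    · rw [Ne, Option.some_inj, corner_injective.eq_iff]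
      revert i; decide
    · revert i; decide
    · revert i; decide
  · have hne : ∀ {k l}, k ≠ l → some (upVert g k) ≠ some (upVert g l) := fun {k l} h h' =>
      h (upVert_injective g (Option.some_inj.1 h'))
    exact ⟨some (upVert g 0), some (upVert g 1), some (upVert g 2), hne (by decide),
      hne (by decide), hne (by decide), lor_upVert g 0, lor_upVert g 1, lor_upVert g 2⟩

/-- Distinct centres are neighbours or far apart. -/
lemma tri_neighbour (g g' : Tri m) (h : g ≠ g') :
    4 ≤ ((g.1 0 : ℤ) - g'.1 0) ^ 2 + ((g.1 1 : ℤ) - g'.1 1) ^ 2 + ((g.1 2 : ℤ) - g'.1 2) ^ 2 ∨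
    ∃ k l, k ≠ l ∧ g'.1 + Pi.single l 1 = g.1 + Pi.single k 1 := by
  rw [or_iff_not_imp_left]
  intro hlt
  push Not at hlt
  have hg := g.2
  have hg' := g'.2
  have hne : ¬ (g.1 0 = g'.1 0 ∧ g.1 1 = g'.1 1 ∧ g.1 2 = g'.1 2) := by
    rintro ⟨h0, h1, h2⟩
    apply h
    ext i
    fin_cases i <;> assumption
  -- All differences are `-1`, `0` or `1`; their sum is 0 and not all vanish, which leaves the six
  -- unit steps of the lattice.
  have bd : ∀ a b c : ℤ, a ^ 2 + b ^ 2 + c ^ 2 < 4 → -1 ≤ a ∧ a ≤ 1 := by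
    intro a b c h
    constructor <;> nlinarith [sq_nonneg b, sq_nonneg c]
  obtain ⟨a1, a2⟩ := bd _ _ _ hlt
  obtain ⟨b1, b2⟩ := bd ((g.1 1 : ℤ) - g'.1 1) ((g.1 0 : ℤ) - g'.1 0) ((g.1 2 : ℤ) - g'.1 2)
    (by linarith)
  obtain ⟨c1, c2⟩ := bd ((g.1 2 : ℤ) - g'.1 2) ((g.1 0 : ℤ) - g'.1 0) ((g.1 1 : ℤ) - g'.1 1)
    (by linarith)
  have mk : ∀ k l : Fin 3, k ≠ l → (∀ i, g'.1 i + (if i = l then 1 else 0) =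
      g.1 i + (if i = k then 1 else 0)) →
      ∃ k l, k ≠ l ∧ g'.1 + Pi.single l 1 = g.1 + Pi.single k 1 := by
    intro k l hkl hi
    refine ⟨k, l, hkl, funext fun i => ?_⟩
    simpa [Pi.single_apply] using hi i
  have cases : ∃ k l : Fin 3, k ≠ l ∧ g'.1 k = g.1 k + 1 ∧ g'.1 l + 1 = g.1 l ∧
      ∀ i, i ≠ k → i ≠ l → g'.1 i = g.1 i := by
    clear hlt bd mk h
    have h6 : (g'.1 0 = g.1 0 + 1 ∧ g'.1 1 + 1 = g.1 1 ∧ g'.1 2 = g.1 2) ∨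
        (g'.1 0 = g.1 0 + 1 ∧ g'.1 2 + 1 = g.1 2 ∧ g'.1 1 = g.1 1) ∨
        (g'.1 1 = g.1 1 + 1 ∧ g'.1 0 + 1 = g.1 0 ∧ g'.1 2 = g.1 2) ∨
        (g'.1 1 = g.1 1 + 1 ∧ g'.1 2 + 1 = g.1 2 ∧ g'.1 0 = g.1 0) ∨
        (g'.1 2 = g.1 2 + 1 ∧ g'.1 0 + 1 = g.1 0 ∧ g'.1 1 = g.1 1) ∨
        (g'.1 2 = g.1 2 + 1 ∧ g'.1 1 + 1 = g.1 1 ∧ g'.1 0 = g.1 0) := by omega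
    rcases h6 with h | h | h | h | h | h
    · exact ⟨0, 1, by decide, h.1, h.2.1, fun i => by fin_cases i <;> simp [h.2.2]⟩
    · exact ⟨0, 2, by decide, h.1, h.2.1, fun i => by fin_cases i <;> simp [h.2.2]⟩
    · exact ⟨1, 0, by decide, h.1, h.2.1, fun i => by fin_cases i <;> simp [h.2.2]⟩
    · exact ⟨1, 2, by decide, h.1, h.2.1, fun i => by fin_cases i <;> simp [h.2.2]⟩
    · exact ⟨2, 0, by decide, h.1, h.2.1, fun i => by fin_cases i <;> simp [h.2.2]⟩
    · exact ⟨2, 1, by decide, h.1, h.2.1, fun i => by fin_cases i <;> simp [h.2.2]⟩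
  obtain ⟨k, l, hkl, h1, h2, h3⟩ := cases
  refine mk k l hkl fun i => ?_
  by_cases hik : i = k
  · subst hik
    simp [hkl, h1]
  · by_cases hil : i = l
    · subst hil
      simp [hik, h2]
    · simp [hik, hil, h3 i hik hil]

lemma lor_sphere_neighbour {g g' : Tri m} {k l : Fin 3} (hkl : k ≠ l)
    (heq : g'.1 + Pi.single l 1 = g.1 + Pi.single k 1) :
    lor (wallVec (.inr g)) (wallVec (.inr g')) = -1 / 2 := by
  have hd : ∀ i, ctr g i - ctr g' i =
      3 * ((if i = l then 1 else 0) - (if i = k then 1 else 0)) := by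
    intro i
    have h := congrFun heq i
    simp only [Pi.add_apply, Pi.single_apply] at h
    have hr : (g'.1 i : ℝ) + (if i = l then 1 else 0) = g.1 i + (if i = k then 1 else 0) := by
      exact_mod_cast h
    simp only [ctr]
    linarith
  rw [lor_sphere_sphere, hd, hd, hd]
  clear hd heq
  fin_cases k <;> fin_cases l <;> simp at hkl ⊢ <;> norm_num

lemma wall_angles (i i' : Wall m) (h : i ≠ i') : lor (wallVec i) (wallVec i') ≤ -1 ∨
    (lor (wallVec i) (wallVec i') = -1 / 2 ∧ ∃ j k : Vert m, j ≠ k ∧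
      lor (vertVec j) (wallVec i) = 0 ∧ lor (vertVec k) (wallVec i) = 0 ∧
      lor (vertVec j) (wallVec i') = 0 ∧ lor (vertVec k) (wallVec i') = 0) := by
  have mixed : ∀ (i : Fin 3) (g : Tri m),
      lor (wallVec (.inr g)) (wallVec (m := m) (.inl i)) ≤ -1 ∨
      (lor (wallVec (.inr g)) (wallVec (m := m) (.inl i)) = -1 / 2 ∧ ∃ j k : Vert m, j ≠ k ∧
        lor (vertVec j) (wallVec (.inr g)) = 0 ∧ lor (vertVec k) (wallVec (.inr g)) = 0 ∧
        lor (vertVec j) (wallVec (m := m) (.inl i)) = 0 ∧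
        lor (vertVec k) (wallVec (m := m) (.inl i)) = 0) := by
    intro i g
    rw [lor_sphere_side]
    rcases Nat.eq_zero_or_pos (g.1 i) with h0 | h0
    · right
      have side : ∀ k, i ≠ k →
          lor (vertVec (some (upVert g k))) (wallVec (m := m) (.inl i)) = 0 := by
        intro k hk
        rw [lor_vert_side]
        simp [upVert, pos, h0, hk]
      refine ⟨by rw [h0]; norm_num, some (upVert g (i + 1)), some (upVert g (i + 2)), ?_,
        lor_upVert g _, lor_upVert g _, side _ ?_, side _ ?_⟩
      · rw [Ne, Option.some_inj, (upVert_injective g).eq_iff]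
        clear h0 side; revert i; decide
      · clear h0 side; revert i; decide
      · clear h0 side; revert i; decide
    · left
      have : (1 : ℝ) ≤ g.1 i := by exact_mod_cast h0
      linarith
  rcases i with i | g <;> rcases i' with i' | g'
  · right
    have hne : i ≠ i' := fun h' => h (by rw [h'])
    obtain ⟨k, hk, hk'⟩ : ∃ k, i ≠ k ∧ i' ≠ k := by
      clear h mixed hne; revert i i'; decide
    rw [lor_side_side, if_neg hne]
    exact ⟨rfl, none, some (corner k), by simp, lor_infty_side i, lor_corner_side hk,
      lor_infty_side i', lor_corner_side hk'⟩
  · rw [lor_comm]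
    rcases mixed i g' with h1 | ⟨h1, j, k, hjk, a, b, c, d⟩
    · exact Or.inl h1
    · exact Or.inr ⟨h1, j, k, hjk, c, d, a, b⟩
  · exact mixed i' g
  · have hne : g ≠ g' := fun h' => h (by rw [h'])
    rcases tri_neighbour g g' hne with h4 | ⟨k, l, hkl, heq⟩
    · left
      have h4' : (4 : ℝ) ≤ ((g.1 0 : ℝ) - g'.1 0) ^ 2 + ((g.1 1 : ℝ) - g'.1 1) ^ 2 +
          ((g.1 2 : ℝ) - g'.1 2) ^ 2 := by exact_mod_cast h4
      rw [lor_sphere_sphere]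
      simp only [ctr]
      linarith
    · right
      refine ⟨lor_sphere_neighbour hkl heq, ?_⟩
      · have hl : 1 ≤ g.1 l := by
          have := congrFun heq l
          simp [hkl.symm] at this
          omega
        have hf : g.1 = (g.1 - Pi.single l 1) + Pi.single l 1 := by
          funext i
          simp only [Pi.add_apply, Pi.sub_apply, Pi.single_apply]
          split_ifs with h
          · subst h; omega
          · rfl
        have hf' : g'.1 = (g.1 - Pi.single l 1) + Pi.single k 1 := by
          have h1 : g'.1 + Pi.single l 1 =
              (g.1 - Pi.single l 1) + Pi.single k 1 + Pi.single l 1 := by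
            rw [heq, add_right_comm, ← hf]
          exact add_right_cancel h1
        -- An edge between two honeycomb cells joins a vertex of the first kind, `g + e_k = g' +
        -- e_l`, to one of the second kind, `g - e_l = g' - e_k`; the subtraction is not truncated
        -- as `g l ≥ 1`.
        refine ⟨some (upVert g k), some (.inr ⟨g.1 - Pi.single l 1, ?_⟩), by simp [upVert],
          lor_upVert g k, lor_down_of_eq hf, lor_up_of_eq heq.symm, lor_down_of_eq hf'⟩
        have hs := g.2
        have e0 := congrFun hf 0
        have e1 := congrFun hf 1
        have e2 := congrFun hf 2
        rw [Pi.add_apply] at e0 e1 e2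
        have e3 : (Pi.single l 1 : Fin 3 → ℕ) 0 + (Pi.single l 1 : Fin 3 → ℕ) 1 +
            (Pi.single l 1 : Fin 3 → ℕ) 2 = 1 := by
          clear e0 e1 e2 hs hf' hf hl heq hkl
          revert l; decide
        omega

/-! ### The cone is spanned by the ideal vertices -/

/-- The cone spanned by the ideal vertices. -/
def vertCone (m : ℕ) : Submodule NNReal (Fin 4 → ℝ) :=
  Submodule.span NNReal (Set.range (vertVec (m := m)))

lemma smul_mem_vertCone {x : Fin 4 → ℝ} (hx : x ∈ vertCone m) {c : ℝ} (hc : 0 ≤ c) :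
    c • x ∈ vertCone m :=
  (vertCone m).smul_mem (⟨c, hc⟩ : NNReal) hx

lemma vertVec_mem_vertCone (j : Vert m) : vertVec j ∈ vertCone m :=
  Submodule.subset_span ⟨j, rfl⟩

/-- A point over a triangle of vertices on a hemisphere and above this hemisphere. -/
lemma mem_vertCone_of_triangle (g : Tri m) (j : Fin 3 → FinVert m)
    (hj : ∀ k, lor (vertVec (some (j k))) (wallVec (.inr g)) = 0) (c : Fin 3 → ℝ)
    (hc : ∀ k, 0 ≤ c k) {z : Fin 3 → ℝ} {v : ℝ}
    (hz : z = c 0 • pos (j 0) + c 1 • pos (j 1) + c 2 • pos (j 2))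
    (hv : lor (vec (m + 1) z v) (wallVec (.inr g)) ≤ 0) : vec (m + 1) z v ∈ vertCone m := by
  set q : Fin 3 → ℝ := fun k => dot (pos (j k)) (pos (j k)) with hq
  have key : vec (m + 1) z v = c 0 • vertVec (some (j 0)) + c 1 • vertVec (some (j 1)) +
      c 2 • vertVec (some (j 2)) +
        (v - (c 0 * q 0 + c 1 * q 1 + c 2 * q 2)) • vertVec (m := m) none := by
    simp only [vertVec, ← vec_smul, ← vec_add]
    congr 1
    · rw [hz, smul_zero, add_zero]
    · ring
  -- Pairing with the wall kills the three vertices and leaves `-1/6` times the coefficient of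
  -- infinity.
  have ht : 0 ≤ v - (c 0 * q 0 + c 1 * q 1 + c 2 * q 2) := by
    rw [key] at hv
    simp only [lor_add_left, lor_smul_left, hj, lor_infty_sphere] at hv
    linarith
  rw [key]
  refine add_mem (add_mem (add_mem ?_ ?_) ?_) ?_
  · exact smul_mem_vertCone (vertVec_mem_vertCone _) (hc 0)
  · exact smul_mem_vertCone (vertVec_mem_vertCone _) (hc 1)
  · exact smul_mem_vertCone (vertVec_mem_vertCone _) (hc 2)
  · exact smul_mem_vertCone (vertVec_mem_vertCone _) ht

/-- A point of the triangle lies in an upward or in a downward triangle of the lattice. -/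
lemma exists_lattice_triangle {a : Fin 3 → ℝ} (ha : ∀ k, 0 ≤ a k) (hs : a 0 + a 1 + a 2 = m + 1) :
    ∃ i : Fin 3 → ℕ, (∀ k, (i k : ℝ) ≤ a k ∧ a k ≤ i k + 1) ∧
      (i 0 + i 1 + i 2 = m ∨ i 0 + i 1 + i 2 + 1 = m) := by
  have h1 : ∀ k, ((⌊a k⌋₊ : ℕ) : ℝ) ≤ a k := fun k => Nat.floor_le (ha k)
  have h2 : ∀ k, a k < ⌊a k⌋₊ + 1 := fun k => Nat.lt_floor_add_one _
  have hle : ⌊a 0⌋₊ + ⌊a 1⌋₊ + ⌊a 2⌋₊ ≤ m + 1 := by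
    have : ((⌊a 0⌋₊ + ⌊a 1⌋₊ + ⌊a 2⌋₊ : ℕ) : ℝ) ≤ (m + 1 : ℕ) := by
      push_cast
      linarith [h1 0, h1 1, h1 2]
    exact_mod_cast this
  have hlt : m + 1 < ⌊a 0⌋₊ + ⌊a 1⌋₊ + ⌊a 2⌋₊ + 3 := by
    have : ((m + 1 : ℕ) : ℝ) < (⌊a 0⌋₊ + ⌊a 1⌋₊ + ⌊a 2⌋₊ + 3 : ℕ) := by
      push_cast
      linarith [h2 0, h2 1, h2 2]
    exact_mod_cast this
  -- If the floors sum to `m + 1`, the point is a lattice point; lowering one positive coordinate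
  -- exhibits it as a corner of an upward triangle.
  by_cases heq : ⌊a 0⌋₊ + ⌊a 1⌋₊ + ⌊a 2⌋₊ = m + 1
  · have hr : ((⌊a 0⌋₊ : ℕ) : ℝ) + ⌊a 1⌋₊ + ⌊a 2⌋₊ = m + 1 := by exact_mod_cast heq
    have hfl : ∀ k, a k = ⌊a k⌋₊ := by
      intro k
      have := h1 0
      have := h1 1
      have := h1 2
      fin_cases k
      · change a 0 = ⌊a 0⌋₊
        linarith
      · change a 1 = ⌊a 1⌋₊
        linarith
      · change a 2 = ⌊a 2⌋₊
        linarith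
    obtain ⟨k, hk⟩ : ∃ k, 1 ≤ ⌊a k⌋₊ := by
      by_contra hc
      push Not at hc
      have := hc 0
      have := hc 1
      have := hc 2
      omega
    refine ⟨fun l => if l = k then ⌊a k⌋₊ - 1 else ⌊a l⌋₊, fun l => ?_, Or.inl ?_⟩
    · dsimp only
      split_ifs with h
      · rw [h, Nat.cast_sub hk]
        have := hfl k
        push_cast
        constructor <;> linarith
      · exact ⟨h1 l, (h2 l).le⟩
    · have key : ∀ (b : Fin 3 → ℕ) (k : Fin 3), 1 ≤ b k → b 0 + b 1 + b 2 = m + 1 →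
          (if 0 = k then b k - 1 else b 0) + (if 1 = k then b k - 1 else b 1) +
            (if 2 = k then b k - 1 else b 2) = m := by
        intro b k hk hb
        fin_cases k <;> simp at hk ⊢ <;> omega
      exact key (fun k => ⌊a k⌋₊) k hk heq
  · refine ⟨fun k => ⌊a k⌋₊, fun k => ⟨h1 k, (h2 k).le⟩, ?_⟩
    dsimp only
    omega

/-- A vertex of a downward triangle of the lattice. -/
def downCorner (i : Fin 3 → ℕ) (hi : i 0 + i 1 + i 2 + 1 = m) (k : Fin 3) : FinVert m :=
  .inl ⟨fun l => if l = k then i l else i l + 1, by fin_cases k <;> simp <;> omega⟩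

/-- An upward lattice triangle has its corners on the hemisphere centred at its midpoint. A downward
one is split at its centroid, a vertex of the second kind, into three triangles, each with its
vertices on one hemisphere. -/
lemma mem_vertCone_of_sum_eq {z : Fin 3 → ℝ} {v : ℝ} (hz : ∀ k, 0 ≤ z k)
    (hs : z 0 + z 1 + z 2 = 3 * ((m : ℝ) + 1) * 1)
    (hv : ∀ g : Tri m, lor (vec (m + 1) z v) (wallVec (.inr g)) ≤ 0) :
    vec (m + 1) z v ∈ vertCone m := by
  obtain ⟨i, hi, hsum | hsum⟩ := exists_lattice_triangle (a := fun k => z k / 3) (m := m)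
    (fun k => by have := hz k; positivity) (by linarith)
  · refine mem_vertCone_of_triangle ⟨i, hsum⟩ (upVert ⟨i, hsum⟩) (lor_upVert _)
      (fun k => z k / 3 - i k) (fun k => by linarith [(hi k).1]) ?_ (hv _)
    have hsr : (i 0 : ℝ) + i 1 + i 2 = m := by exact_mod_cast hsum
    have h2 : z 2 = 3 * ((m : ℝ) + 1) - z 0 - z 1 := by linarith
    have hi2 : (i 2 : ℝ) = m - i 0 - i 1 := by linarith
    ext k
    fin_cases k <;> simp [upVert, pos] <;> rw [h2, hi2] <;> ring
  · have hsr : (i 0 : ℝ) + i 1 + i 2 + 1 = m := by exact_mod_cast hsum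
    set b : Fin 3 → ℝ := fun k => i k + 1 - z k / 3 with hb
    have hb0 : ∀ k, 0 ≤ b k := fun k => by simp only [hb]; linarith [(hi k).2]
    have hbs : b 0 + b 1 + b 2 = 1 := by simp only [hb]; linarith
    have hzb : ∀ k, z k = 3 * (i k + 1 - b k) := fun k => by simp only [hb]; ring
    -- The `b k` are the barycentric coordinates in the downward triangle. The smallest one selects
    -- the piece containing the point, where the weights become `3 * b k` at the centroid and `b l -
    -- b k` at the other two corners.
    obtain ⟨k, hk⟩ := Finite.exists_min b
    have hgs : ∀ k, (i + Pi.single k 1 : Fin 3 → ℕ) 0 + (i + Pi.single k 1 : Fin 3 → ℕ) 1 +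
        (i + Pi.single k 1 : Fin 3 → ℕ) 2 = m := by
      intro k
      fin_cases k <;> simp <;> omega
    have hcorner : ∀ k l : Fin 3, k ≠ l → lor (vertVec (some (downCorner i hsum l)))
        (wallVec (.inr ⟨i + Pi.single k 1, hgs k⟩)) = 0 := by
      intro k l hkl
      have hex : ∃ p : Fin 3, p ≠ k ∧ p ≠ l := by
        revert k l; decide
      obtain ⟨p, hpk, hpl⟩ := hex
      refine lor_up_of_eq (k := p) (funext fun q => ?_)
      simp only [Pi.add_apply, Pi.single_apply]
      have : q = k ∨ q = l ∨ q = p := by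
        revert k l p q; decide
      rcases this with rfl | rfl | rfl
      · simp [hkl, hpk.symm]
      · simp [hkl.symm, hpl.symm]
      · simp [hpk, hpl]
    refine mem_vertCone_of_triangle ⟨i + Pi.single k 1, hgs k⟩
      ![.inr ⟨i, hsum⟩, downCorner i hsum (k + 1), downCorner i hsum (k + 2)] ?_
      ![3 * b k, b (k + 1) - b k, b (k + 2) - b k] ?_ ?_ (hv _)
    · intro l
      fin_cases l
      · exact lor_down_of_eq (k := k) rfl
      · exact hcorner _ _ (by clear hk; revert k; decide)
      · exact hcorner _ _ (by clear hk; revert k; decide)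
    · intro l
      have h0 := hb0 k
      have h1 := hk (k + 1)
      have h2 := hk (k + 2)
      fin_cases l
      · simpa using h0
      · simpa using h1
      · simpa using h2
    · ext l
      rw [hzb]
      have hb2 : b 2 = 1 - b 0 - b 1 := by linarith
      clear_value b
      clear hk
      fin_cases k <;> fin_cases l <;> simp [pos, downCorner] <;> rw [hb2] <;> ring

/-- The side walls give `z ≥ 0`, hence `u ≥ 0`. For `u > 0` rescale to `u = 1`; for `u = 0` also `z
= 0`, and any hemisphere forces a nonnegative multiple of infinity. -/
lemma mem_vertCone {x : Fin 4 → ℝ} (hx : ∀ i : Wall m, lor x (wallVec i) ≤ 0) :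
    x ∈ vertCone m := by
  obtain ⟨z, v, rfl⟩ := exists_eq_vec (side_ne_zero m) x
  obtain ⟨u, hu⟩ : ∃ u, z 0 + z 1 + z 2 = 3 * ((m : ℝ) + 1) * u :=
    ⟨(z 0 + z 1 + z 2) / (3 * (m + 1)), by have := side_ne_zero m; field_simp⟩
  have hz : ∀ k, 0 ≤ z k := by
    intro k
    have := hx (.inl k)
    rw [lor_vec_side v hu] at this
    linarith
  have hm : (0 : ℝ) < 3 * (m + 1) := by positivity
  have hu0 : 0 ≤ u := by
    by_contra h
    push Not at h
    have := mul_neg_of_pos_of_neg hm h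
    linarith [hz 0, hz 1, hz 2]
  rcases hu0.eq_or_lt with rfl | hpos
  · have hz0 : z = 0 := by
      have h0 := hz 0
      have h1 := hz 1
      have h2 := hz 2
      ext k
      fin_cases k
      · change z 0 = 0
        linarith
      · change z 1 = 0
        linarith
      · change z 2 = 0
        linarith
    have hv := hx (.inr ⟨Pi.single 0 m, by simp⟩)
    rw [lor_vec_sphere v hu, hz0] at hv
    have hv0 : 0 ≤ v := by
      simp only [dot, Pi.zero_apply] at hv
      linarith
    have : vec (m + 1) z v = v • vertVec (m := m) none := by
      rw [vertVec, ← vec_smul, hz0, smul_zero, mul_one]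
    rw [this]
    exact smul_mem_vertCone (vertVec_mem_vertCone _) hv0
  · have hsc : vec (m + 1) z v = u • vec (m + 1) (u⁻¹ • z) (u⁻¹ * v) := by
      rw [vec_smul, smul_smul, mul_inv_cancel₀ hpos.ne', one_smul]
    rw [hsc]
    refine smul_mem_vertCone (mem_vertCone_of_sum_eq (fun k => ?_) ?_ fun g => ?_) hpos.le
    · have := hz k
      simp only [Pi.smul_apply, smul_eq_mul]
      positivity
    · simp only [Pi.smul_apply, smul_eq_mul]
      field_simp
      linarith
    · have := hx (.inr g)
      rw [vec_smul, lor_smul_left]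
      exact mul_nonpos_of_nonneg_of_nonpos (by positivity) this

lemma sum_center : (fun _ : Fin 3 => (m : ℝ) + 1) 0 + (fun _ : Fin 3 => (m : ℝ) + 1) 1 +
    (fun _ : Fin 3 => (m : ℝ) + 1) 2 = 3 * ((m : ℝ) + 1) * 1 := by
  ring

instance (m : ℕ) : Fintype (Vert m) := Fintype.ofFinite _

instance (m : ℕ) : Nontrivial (Vert m) := ⟨none, some (corner 0), by simp⟩

/-- The cone over the ideal polyhedron with three sides of length `m + 1`. -/
def triCone (m : ℕ) : IdealCone (Wall m) (Vert m) where
  e := wallVec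
  w := vertVec
  -- A point over the barycentre `z`. For every centre `c` one has `2 z·c = 6 (m + 1)²`, so this `v`
  -- exceeds `2 z·c - |c|² + 6` and the point lies above all hemispheres.
  center := vec (m + 1) (fun _ => (m : ℝ) + 1) (6 * ((m : ℝ) + 1) ^ 2 + 7)
  e_unit := wallVec_unit
  w_null := vertVec_null
  w_pos := vertVec_pos
  w_neg := vertVec_neg
  w_le := vert_wall_nonpos
  dual x hx := by
    obtain ⟨c, hc⟩ := (Submodule.mem_span_range_iff_exists_fun NNReal).1 (mem_vertCone hx)
    exact ⟨fun j => c j, fun j => (c j).2, hc.symm⟩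
  center_neg := by
    rw [lor_vec (side_ne_zero m) _ _ sum_center sum_center]
    simp only [dot]
    nlinarith [sq_nonneg ((m : ℝ) + 1)]
  center_pos := by
    have hm := side_ne_zero m
    have e : ((m : ℝ) + 1 + (m + 1) + (m + 1)) / (3 * (m + 1)) = 1 := by field_simp; norm_num
    simp only [vec, Matrix.cons_val_zero, e]
    nlinarith [sq_nonneg ((m : ℝ) + 1)]
  center_lt i := by
    rcases i with i | g
    · rw [lor_vec_side _ sum_center]
      have : (0 : ℝ) < m + 1 := by positivity
      linarith
    · rw [lor_vec_sphere _ sum_center]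
      have h : dot (fun _ => (m : ℝ) + 1) (ctr g) = 3 * ((m : ℝ) + 1) ^ 2 := by
        have := sum_ctr g
        simp only [dot, ← mul_add, this]
        ring
      have h2 : 0 ≤ dot (ctr g) (ctr g) := by
        simp only [dot]
        nlinarith [sq_nonneg (ctr g 0), sq_nonneg (ctr g 1), sq_nonneg (ctr g 2)]
      rw [h]
      linarith
  three := wall_three
  walls := wall_angles

/-! ### The adjacency graph -/

lemma adj_side_side {i i' : Fin 3} :
    lor (wallVec (m := m) (.inl i)) (wallVec (m := m) (.inl i')) = -1 / 2 ↔ i ≠ i' := by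
  rw [lor_side_side]
  split_ifs with h
  · simp only [h, ne_eq, not_true_eq_false, iff_false]
    norm_num
  · simp [h]

lemma adj_sphere_side {g : Tri m} {i : Fin 3} :
    lor (wallVec (.inr g)) (wallVec (m := m) (.inl i)) = -1 / 2 ↔ g.1 i = 0 := by
  rw [lor_sphere_side]
  constructor
  · intro h
    have : (g.1 i : ℝ) = 0 := by linarith
    exact_mod_cast this
  · intro h
    rw [h]
    norm_num

lemma adj_sphere_sphere {g g' : Tri m} :
    lor (wallVec (.inr g)) (wallVec (.inr g')) = -1 / 2 ↔
      ∃ k l, k ≠ l ∧ g'.1 + Pi.single l 1 = g.1 + Pi.single k 1 := by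
  constructor
  · intro h
    have hne : g ≠ g' := by
      rintro rfl
      rw [wallVec_unit] at h
      norm_num at h
    refine (tri_neighbour g g' hne).resolve_left fun h4 => ?_
    have h4' : (4 : ℝ) ≤ ((g.1 0 : ℝ) - g'.1 0) ^ 2 + ((g.1 1 : ℝ) - g'.1 1) ^ 2 +
        ((g.1 2 : ℝ) - g'.1 2) ^ 2 := by exact_mod_cast h4
    rw [lor_sphere_sphere] at h
    simp only [ctr] at h
    linarith
  · rintro ⟨k, l, hkl, h⟩
    exact lor_sphere_neighbour hkl h

/-- The centre reached from `g` by a step from the `l`-th towards the `k`-th corner, if there is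
one. -/
def step (g : Tri m) (k l : Fin 3) : Tri m :=
  if h : 1 ≤ g.1 l then
    ⟨fun i => g.1 i + (if i = k then 1 else 0) - (if i = l then 1 else 0), by
      have := g.2
      fin_cases k <;> fin_cases l <;> simp at h ⊢ <;> omega⟩
  -- An arbitrary value: `stepLabels` admits only steps with `g l ≠ 0`.
  else g

lemma step_apply {g : Tri m} {l : Fin 3} (h : 1 ≤ g.1 l) (k i : Fin 3) :
    (step g k l).1 i = g.1 i + (if i = k then 1 else 0) - (if i = l then 1 else 0) := by
  rw [step, dif_pos h]

lemma step_add {g : Tri m} {k l : Fin 3} (h : 1 ≤ g.1 l) :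
    (step g k l).1 + Pi.single l 1 = g.1 + Pi.single k 1 := by
  funext i
  simp only [Pi.add_apply, Pi.single_apply, step_apply h]
  by_cases hi : i = l
  · subst hi
    simp only [if_true]
    omega
  · simp [hi]

/-- The number of sides of the triangle on which `g` lies. -/
def zeroCount (g : Tri m) : ℕ := (Finset.univ.filter fun i => g.1 i = 0).card

/-- Labels for the neighbours of a centre whose vanishing coordinates are given by `Z`: diagonal
pairs for sides, other pairs for steps. -/
def stepLabels (Z : Fin 3 → Bool) : Finset (Fin 3 × Fin 3) :=
  Finset.univ.filter fun p => if p.1 = p.2 then Z p.1 = true else Z p.2 = false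

/-- Each vanishing coordinate removes two of the six steps and adds one side. -/
lemma card_stepLabels : ∀ Z : Fin 3 → Bool,
    (stepLabels Z).card + (Finset.univ.filter fun i => Z i = true).card = 6 := by
  decide

lemma encard_neighbours_sphere (g : Tri m) :
    {i : Wall m | lor (wallVec (.inr g)) (wallVec i) = -1 / 2}.encard = (6 - zeroCount g : ℕ) := by
  classical
  set Z : Fin 3 → Bool := fun i => decide (g.1 i = 0) with hZ
  let f : Fin 3 × Fin 3 → Wall m := fun p =>
    if p.1 = p.2 then .inl p.1 else .inr (step g p.1 p.2)
  have hmem : ∀ p : Fin 3 × Fin 3, p ∈ stepLabels Z ↔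
      if p.1 = p.2 then g.1 p.1 = 0 else 1 ≤ g.1 p.2 := by
    intro p
    simp only [stepLabels, hZ, Finset.mem_filter, Finset.mem_univ, true_and, decide_eq_true_eq,
      decide_eq_false_iff_not, Nat.one_le_iff_ne_zero]
  have himg : {i : Wall m | lor (wallVec (.inr g)) (wallVec i) = -1 / 2} = f '' stepLabels Z := by
    ext i
    simp only [Set.mem_ofPred_eq, Set.mem_image, Finset.mem_coe, hmem]
    constructor
    · intro h
      rcases i with i | g'
      · exact ⟨(i, i), by simpa using adj_sphere_side.1 h, by simp [f]⟩
      · obtain ⟨k, l, hkl, heq⟩ := adj_sphere_sphere.1 h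
        have hl : 1 ≤ g.1 l := by
          have := congrFun heq l
          simp [hkl.symm] at this
          omega
        refine ⟨(k, l), by simpa [hkl] using hl, ?_⟩
        simp only [f, hkl, if_false]
        congr 1
        apply Subtype.ext
        exact add_right_cancel ((step_add hl).trans heq.symm)
    · rintro ⟨⟨k, l⟩, hp, rfl⟩
      by_cases hkl : k = l
      · subst hkl
        simp only [if_true] at hp
        simp only [f, if_true]
        exact adj_sphere_side.2 hp
      · simp only [hkl, if_false] at hp
        simp only [f, hkl, if_false]
        exact adj_sphere_sphere.2 ⟨k, l, hkl, step_add hp⟩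
  have hinj : Set.InjOn f (stepLabels Z) := by
    rintro ⟨k, l⟩ hp ⟨k', l'⟩ hp' heq
    rw [Finset.mem_coe, hmem] at hp hp'
    dsimp only at hp hp'
    simp only [f] at heq
    by_cases hkl : k = l <;> by_cases hkl' : k' = l'
    · subst hkl hkl'
      simpa using heq
    · simp [hkl, hkl'] at heq
    · simp [hkl, hkl'] at heq
    · simp only [hkl, hkl', if_false, Sum.inr.injEq] at heq hp hp'
      have h : ∀ i, (step g k l).1 i = (step g k' l').1 i := fun i => by rw [heq]
      simp only [step_apply hp, step_apply hp'] at h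
      have h1 := h k
      have h2 := h l
      -- The label is recovered from the step: `k` is the coordinate that grows and `l` the one that
      -- drops.
      have e1 : k = k' := by
        by_contra hne
        simp only [if_true, hkl, if_false, hne] at h1
        split_ifs at h1 <;> omega
      have e2 : l = l' := by
        by_contra hne
        have hlk : l ≠ k' := fun h => hkl (e1.trans h.symm)
        have hlk' : l ≠ k := fun h => hkl h.symm
        simp only [if_true, hlk, hlk', if_false, hne] at h2
        omega
      rw [e1, e2]
  rw [himg, hinj.encard_image, Set.encard_coe_eq_coe_finsetCard]
  have := card_stepLabels Z
  have hz : (Finset.univ.filter fun i => Z i = true).card = zeroCount g := by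
    simp [hZ, zeroCount]
  rw [hz] at this
  congr 1
  omega

/-- The centre on the `i`-th side with `i + 1`-st coordinate `t`. -/
def sideTri (i : Fin 3) (t : ℕ) (ht : t ≤ m) : Tri m :=
  ⟨fun l => if l = i then 0 else if l = i + 1 then t else m - t, by
    fin_cases i <;> simp <;> omega⟩

lemma eq_sideTri {g : Tri m} {i : Fin 3} (h : g.1 i = 0) :
    ∃ ht : g.1 (i + 1) ≤ m, g = sideTri i (g.1 (i + 1)) ht := by
  have hs : g.1 i + g.1 (i + 1) + g.1 (i + 2) = m := by
    have := g.2
    fin_cases i <;> simp <;> omega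
  refine ⟨by omega, ?_⟩
  apply Subtype.ext
  funext l
  simp only [sideTri]
  split_ifs with h1 h2
  · rw [h1, h]
  · rw [h2]
  · have : l = i + 2 := by
      clear h hs
      revert i l; decide
    rw [this]
    omega

lemma encard_side (i : Fin 3) : {g : Tri m | g.1 i = 0}.encard = (m + 1 : ℕ) := by
  have himg : {g : Tri m | g.1 i = 0} =
      Set.range fun t : Fin (m + 1) => sideTri i t (Nat.le_of_lt_succ t.2) := by
    ext g
    constructor
    · intro h
      obtain ⟨ht, hg⟩ := eq_sideTri h
      exact ⟨⟨_, Nat.lt_succ_of_le ht⟩, hg.symm⟩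
    · rintro ⟨t, rfl⟩
      simp [sideTri]
  have hinj : Function.Injective
      fun t : Fin (m + 1) => sideTri i t (Nat.le_of_lt_succ t.2) := by
    intro t t' h
    have h1 := congrFun (congrArg Subtype.val h) (i + 1)
    have hne : i + 1 ≠ i := by clear h1 h himg; revert i; decide
    simp only [sideTri, hne, if_false, if_true] at h1
    exact Fin.ext h1
  rw [himg, ← Set.image_univ, hinj.encard_image, Set.encard_univ]
  simp

lemma encard_neighbours_side (i : Fin 3) :
    {i' : Wall m | lor (wallVec (m := m) (.inl i)) (wallVec i') = -1 / 2}.encard = (m + 1 + 2 : ℕ) := by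
  have h : {i' : Wall m | lor (wallVec (m := m) (.inl i)) (wallVec i') = -1 / 2} =
      Sum.inr '' {g : Tri m | g.1 i = 0} ∪ Sum.inl '' {i' | i ≠ i'} := by
    ext w
    rcases w with i' | g
    · simpa using adj_side_side
    · rw [Set.mem_ofPred_eq, lor_comm, adj_sphere_side]
      simp
  rw [h, Set.encard_union_eq, Sum.inr_injective.encard_image, Sum.inl_injective.encard_image,
    encard_side, Set.encard_eq_coe_toFinset_card]
  · have : (({i' : Fin 3 | i ≠ i'} : Set (Fin 3)).toFinset).card = 2 := by
      fin_cases i <;> rfl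
    rw [this]
    norm_cast
  · rw [Set.disjoint_left]
    rintro _ ⟨g, -, rfl⟩ ⟨i', -, h⟩
    cases h

/-! ### Counting -/

/-- The partial sums `f 0 ≤ f 0 + f 1 ≤ k` determine `f`. -/
lemma card_tri (k : ℕ) : Nat.card (Tri k) * 2 = (k + 1) * (k + 2) := by
  let φ : Tri k ≃ Σ a : Fin (k + 1), Fin (a + 1) :=
    { toFun := fun f => ⟨⟨f.1 0 + f.1 1, by have := f.2; omega⟩,
        ⟨f.1 0, by dsimp only; omega⟩⟩
      invFun := fun p => ⟨![p.2, p.1 - p.2, k - p.1], by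
        have := p.1.2
        have := p.2.2
        simp
        omega⟩
      left_inv := by
        intro f
        apply Subtype.ext
        funext i
        have := f.2
        fin_cases i <;> simp
        omega
      right_inv := by
        rintro ⟨⟨a, ha⟩, ⟨b, hb⟩⟩
        have hab : b + (a - b) = a := by dsimp only at hb; omega
        simp only [Matrix.cons_val_zero, Matrix.cons_val_one, Sigma.mk.injEq]
        exact ⟨Fin.ext hab, (Fin.heq_ext_iff (by simp [hab])).2 rfl⟩ }
  rw [Nat.card_congr φ, Nat.card_eq_fintype_card, Fintype.card_sigma]
  simp only [Fintype.card_fin]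
  rw [Fin.sum_univ_eq_sum_range (fun a => a + 1) (k + 1)]
  induction k with
  | zero => simp
  | succ k ih =>
    rw [Finset.sum_range_succ, add_mul, ih]
    ring

lemma card_wall (m : ℕ) : Nat.card (Wall m) = ((m + 1) ^ 2 + (m + 1) + 6) / 2 := by
  have h := card_tri m
  have h2 : (m + 1) ^ 2 + (m + 1) + 6 = (m + 1) * (m + 2) + 6 := by ring
  rw [Nat.card_sum, h2, ← h, Nat.card_eq_fintype_card, Fintype.card_fin]
  omega

lemma card_vert (m : ℕ) : Nat.card (Vert m) = (m + 1) ^ 2 + (m + 1) + 2 := by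
  have h := card_tri (m + 1)
  rw [Finite.card_option, Nat.card_sum]
  rcases m with _ | k
  · have : IsEmpty {f : Fin 3 → ℕ // f 0 + f 1 + f 2 + 1 = 0} := ⟨fun f => by
      have := f.2
      omega⟩
    rw [Nat.card_of_isEmpty (α := {f : Fin 3 → ℕ // f 0 + f 1 + f 2 + 1 = 0})]
    omega
  · have h1 : Nat.card {f : Fin 3 → ℕ // f 0 + f 1 + f 2 + 1 = k + 1} = Nat.card (Tri k) :=
      Nat.card_congr (Equiv.subtypeEquivRight fun f => by omega)
    have h2 := card_tri k
    rw [h1]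
    nlinarith

/-- Lowering all three coordinates by 1 gives a triangle of side `m - 3`; for `m < 3` there is no
interior centre and the truncated product is 0. -/
lemma encard_interior (hm : 1 ≤ m) :
    {g : Tri m | ∀ i, g.1 i ≠ 0}.encard = ((m + 1 - 3) * (m + 1 - 2) / 2 : ℕ) := by
  by_cases h3 : 3 ≤ m
  · obtain ⟨k, rfl⟩ := Nat.exists_eq_add_of_le h3
    let f : Tri k → Tri (3 + k) := fun g => ⟨fun i => g.1 i + 1, by
      have := g.2
      dsimp only
      omega⟩
    have himg : {g : Tri (3 + k) | ∀ i, g.1 i ≠ 0} = Set.range f := by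
      ext g
      constructor
      · intro h
        have h0 : ∀ i, 1 ≤ g.1 i := fun i => Nat.one_le_iff_ne_zero.2 (h i)
        refine ⟨⟨fun i => g.1 i - 1, ?_⟩, ?_⟩
        · have := g.2
          have := h0 0
          have := h0 1
          have := h0 2
          dsimp only
          omega
        · apply Subtype.ext
          funext i
          have := h0 i
          simp only [f]
          omega
      · rintro ⟨g, rfl⟩ i
        simp [f]
    have hinj : Function.Injective f := by
      intro g g' h
      apply Subtype.ext
      funext i
      have := congrFun (congrArg Subtype.val h) i
      simpa [f] using this
    rw [himg, ← Set.image_univ, hinj.encard_image, Set.encard_univ, ENat.card_eq_coe_natCard]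
    have h := card_tri k
    congr 1
    have e1 : 3 + k + 1 - 3 = k + 1 := by omega
    have e2 : 3 + k + 1 - 2 = k + 2 := by omega
    rw [e1, e2, ← h]
    omega
  · have he : {g : Tri m | ∀ i, g.1 i ≠ 0} = ∅ := by
      refine Set.eq_empty_of_forall_notMem fun g hg => ?_
      have := g.2
      have := hg 0
      have := hg 1
      have := hg 2
      omega
    have : (m + 1 - 3) = 0 := by omega
    rw [he, this]
    simp

/-- The centre in the `k`-th corner. -/
def cornerTri (m : ℕ) (k : Fin 3) : Tri m :=
  ⟨Pi.single k m, by fin_cases k <;> simp⟩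

lemma eq_cornerTri {g : Tri m} {i : Fin 3} (h1 : g.1 i = 0) (h2 : g.1 (i + 1) = 0) :
    g = cornerTri m (i + 2) := by
  apply Subtype.ext
  funext l
  have := g.2
  fin_cases i <;> fin_cases l <;> simp [cornerTri] at * <;> omega

lemma eq_cornerTri' {g : Tri m} {i : Fin 3} (h1 : g.1 i = 0) (h2 : g.1 (i + 2) = 0) :
    g = cornerTri m (i + 1) := by
  apply Subtype.ext
  funext l
  have := g.2
  fin_cases i <;> fin_cases l <;> simp [cornerTri] at * <;> omega

lemma cornerTri_apply_of_ne {i k : Fin 3} (h : i ≠ k) : (cornerTri m k).1 i = 0 := by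
  simp [cornerTri, h]

lemma zeroCount_cornerTri (hm : 1 ≤ m) (k : Fin 3) : zeroCount (cornerTri m k) = 2 := by
  have : (Finset.univ.filter fun i => (cornerTri m k).1 i = 0) =
      Finset.univ.filter fun i => i ≠ k := by
    ext i
    simp only [Finset.mem_filter, Finset.mem_univ, true_and, cornerTri, Pi.single_apply]
    split_ifs with h
    · simp only [h, ne_eq, not_true_eq_false, iff_false]
      omega
    · simp [h]
  rw [zeroCount, this]
  clear this
  revert k; decide

lemma unique_zero {g : Tri m} {i : Fin 3} (h : g.1 i = 0) (hc : ∀ k, g ≠ cornerTri m k)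
    {l : Fin 3} (hl : g.1 l = 0) : l = i := by
  have h3 : ∀ l i : Fin 3, l = i ∨ l = i + 1 ∨ l = i + 2 := by decide
  rcases h3 l i with h' | h' | h'
  · exact h'
  · exact absurd (eq_cornerTri h (h' ▸ hl)) (hc _)
  · exact absurd (eq_cornerTri' h (h' ▸ hl)) (hc _)

lemma zeroCount_side {g : Tri m} {i : Fin 3} (h : g.1 i = 0) (hc : ∀ k, g ≠ cornerTri m k) :
    zeroCount g = 1 := by
  have : (Finset.univ.filter fun i => g.1 i = 0) = {i} := by
    ext l
    simp only [Finset.mem_filter, Finset.mem_univ, true_and, Finset.mem_singleton]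
    exact ⟨fun hl => unique_zero h hc hl, fun hl => hl ▸ h⟩
  rw [zeroCount, this, Finset.card_singleton]

/-- Off the corners a centre lies on one side only, with a position from `1` to `m - 1` along it. -/
lemma encard_sides (hm : 1 ≤ m) :
    {g : Tri m | (∀ k, g ≠ cornerTri m k) ∧ ∃ i, g.1 i = 0}.encard = (3 * (m + 1 - 2) : ℕ) := by
  let f : Fin 3 × Fin (m - 1) → Tri m := fun p => sideTri p.1 (p.2 + 1) (by have := p.2.2; omega)
  have ne1 : ∀ i : Fin 3, i + 1 ≠ i := by decide
  have ne2 : ∀ i : Fin 3, i + 2 ≠ i := by decide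
  have ne3 : ∀ i : Fin 3, i + 2 ≠ i + 1 := by decide
  have f0 : ∀ p, (f p).1 p.1 = 0 := fun p => by simp [f, sideTri]
  have f1 : ∀ p, (f p).1 (p.1 + 1) = p.2 + 1 := fun p => by simp [f, sideTri]
  have f2 : ∀ p, (f p).1 (p.1 + 2) = m - (p.2 + 1) := fun p => by
    simp [f, sideTri, ne3]
  have hz : ∀ p l, (f p).1 l = 0 → l = p.1 := by
    intro p l hl
    have h3 : ∀ l i : Fin 3, l = i ∨ l = i + 1 ∨ l = i + 2 := by decide
    rcases h3 l p.1 with h | h | h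
    · exact h
    · rw [h, f1] at hl
      omega
    · rw [h, f2] at hl
      have := p.2.2
      omega
  have himg : {g : Tri m | (∀ k, g ≠ cornerTri m k) ∧ ∃ i, g.1 i = 0} = Set.range f := by
    ext g
    constructor
    · rintro ⟨hc, i, hi⟩
      obtain ⟨ht, hg⟩ := eq_sideTri hi
      have h1 : g.1 (i + 1) ≠ 0 := fun h => ne1 i (unique_zero hi hc h)
      have h2 : g.1 (i + 2) ≠ 0 := fun h => ne2 i (unique_zero hi hc h)
      have h2' : g.1 (i + 2) = m - g.1 (i + 1) := by
        conv_lhs => rw [hg]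
        simp [sideTri, ne3]
      refine ⟨(i, ⟨g.1 (i + 1) - 1, by omega⟩), ?_⟩
      conv_rhs => rw [hg]
      simp only [f]
      congr 1
      omega
    · rintro ⟨p, rfl⟩
      refine ⟨fun k hk => ?_, p.1, f0 p⟩
      have hex : ∃ a b : Fin 3, a ≠ b ∧ a ≠ k ∧ b ≠ k := by
        clear hk
        revert k; decide
      obtain ⟨a, b, hab, ha, hb⟩ := hex
      refine hab ((hz p a ?_).trans (hz p b ?_).symm)
      · rw [hk, cornerTri_apply_of_ne ha]
      · rw [hk, cornerTri_apply_of_ne hb]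
  have hinj : Function.Injective f := by
    intro p q h
    have h1 : p.1 = q.1 := hz q p.1 (by rw [← h, f0])
    have h2 := f1 p
    rw [h, h1, f1] at h2
    refine Prod.ext h1 (Fin.ext ?_)
    omega
  rw [himg, ← Set.image_univ, hinj.encard_image, Set.encard_univ, ENat.card_eq_coe_natCard,
    Nat.card_prod]
  simp

/-! ### The polyhedra -/

/-- The ideal polyhedron with `(n + 2)`-gons at one vertex, for `n = m + 1`. -/
def triPoly (m : ℕ) : Set H3 := (triCone m).poly

lemma isGon_sphere {g : Tri m} {k : ℕ} (h : 6 - zeroCount g = k) :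
    IsGon (triPoly m) k ((triCone m).face (.inr g)) :=
  (triCone m).isGon_iff.2 (by rw [← h]; exact encard_neighbours_sphere g)

lemma encard_image_sphere (s : Set (Tri m)) :
    ((fun g => (triCone m).face (.inr g)) '' s).encard = s.encard :=
  ((triCone m).face_injective.comp Sum.inr_injective).encard_image s

lemma hasStructure (m : ℕ) : HasStructure (m + 1) (triPoly m) := by
  set C := triCone m with hC
  have adj : ∀ {i i' : Wall m}, Adjacent (triPoly m) (C.face i) (C.face i') ↔
      lor (wallVec i) (wallVec i') = -1 / 2 := C.adjacent_iff
  have hfaces : faces (triPoly m) = Set.range C.face := C.faces_poly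
  have sphereA : ∀ g, C.face (.inr g) ∉ Set.range fun i : Fin 3 => C.face (.inl i) := by
    rintro g ⟨i, hi⟩
    cases C.face_injective hi
  have sphereB : ∀ {g}, C.face (.inr g) ∉ (Set.range fun i : Fin 3 =>
      C.face (.inr (cornerTri m (i + 2)))) ↔ ∀ k, g ≠ cornerTri m k := by
    intro g
    have surj : ∀ k : Fin 3, ∃ i : Fin 3, k = i + 2 := by decide
    constructor
    · rintro h k rfl
      obtain ⟨i, rfl⟩ := surj k
      exact h ⟨i, rfl⟩
    · rintro h ⟨i, hi⟩
      exact h _ (Sum.inr_injective (C.face_injective hi)).symm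
  -- The hemisphere meeting the sides `i` and `i + 1` is the one in the corner opposite to the
  -- remaining side, which carries the index `i + 2`.
  refine ⟨C.point none, ?_, fun i => C.face (.inl i), fun i => C.face (.inr (cornerTri m (i + 2))),
    C.face_injective.comp Sum.inl_injective, ?_, ?_, ?_, ?_, ?_, ?_, ?_, ?_, ?_⟩
  · rw [triPoly, C.idealVertices_poly]
    exact ⟨none, rfl⟩
  · ext F
    rw [hfaces]
    constructor
    · rintro ⟨⟨w, rfl⟩, hw⟩
      rw [C.point_mem_pointsAtInfinity_face] at hw
      rcases w with i | g
      · exact ⟨i, rfl⟩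
      · have h := lor_infty_sphere g
        rw [show lor (vertVec (m := m) none) (wallVec (.inr g)) = 0 from hw] at h
        norm_num at h
    · rintro ⟨i, rfl⟩
      exact ⟨⟨_, rfl⟩, (C.point_mem_pointsAtInfinity_face _ _).2 (lor_infty_side i)⟩
  · intro i j hij
    exact adj.2 (adj_side_side.2 hij)
  · intro i
    exact C.isGon_iff.2 (encard_neighbours_side i)
  · intro i
    ext F
    constructor
    · rintro ⟨h1, h2, h3⟩
      obtain ⟨w, rfl⟩ : F ∈ Set.range C.face := hfaces ▸ h1.1
      rcases w with k | g
      · have a := adj_side_side.1 (adj.1 h1)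
        have b := adj_side_side.1 (adj.1 h2)
        have c : k ≠ i + 2 := fun h => h3 (by rw [h])
        exfalso
        clear h1 h2 h3
        revert k i; decide
      · rw [eq_cornerTri (adj_sphere_side.1 (adj.1 h1)) (adj_sphere_side.1 (adj.1 h2))]
        rfl
    · rintro rfl
      refine ⟨adj.2 (adj_sphere_side.2 (cornerTri_apply_of_ne ?_)),
        adj.2 (adj_sphere_side.2 (cornerTri_apply_of_ne ?_)), fun h => ?_⟩
      · revert i; decide
      · revert i; decide
      · cases C.face_injective h
  · intro hm i
    -- The only centre has three vanishing coordinates, so its face is a triangle and all `B i`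
    -- coincide.
    obtain rfl : m = 0 := by omega
    have hz : ∀ g : Tri 0, g.1 = 0 := by
      intro g
      have := g.2
      funext i
      fin_cases i <;> simp <;> omega
    have hsub : ∀ g g' : Tri 0, g = g' := fun g g' => Subtype.ext ((hz g).trans (hz g').symm)
    refine ⟨congrArg (fun g => C.face (.inr g)) (hsub _ _), isGon_sphere ?_⟩
    simp [zeroCount, hz]
  · intro hm
    have hm1 : 1 ≤ m := by omega
    refine ⟨fun i j h => ?_, fun i => isGon_sphere (by rw [zeroCount_cornerTri hm1])⟩
    have h1 := Sum.inr_injective (C.face_injective h)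
    by_contra hne
    have h2 := cornerTri_apply_of_ne (m := m) (i := i + 2) (k := j + 2) (by simpa using hne)
    rw [← h1] at h2
    simp [cornerTri] at h2
    omega
  · intro F hF hA hB hadj
    obtain ⟨w, rfl⟩ : F ∈ Set.range C.face := hfaces ▸ hF
    rcases w with k | g
    · exact absurd ⟨k, rfl⟩ hA
    · obtain ⟨i, hi⟩ := hadj
      have h0 := adj_sphere_side.1 (adj.1 hi)
      have hc := sphereB.1 hB
      exact ⟨⟨i, hi, fun l hl => unique_zero h0 hc (adj_sphere_side.1 (adj.1 hl))⟩,
        isGon_sphere (by rw [zeroCount_side h0 hc])⟩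
  · intro F hF hA hadj
    obtain ⟨w, rfl⟩ : F ∈ Set.range C.face := hfaces ▸ hF
    rcases w with k | g
    · exact absurd ⟨k, rfl⟩ hA
    · refine isGon_sphere ?_
      have : ∀ i, g.1 i ≠ 0 := fun i h => hadj i (adj.2 (adj_sphere_side.2 h))
      simp [zeroCount, this]
  · intro hm
    have hm1 : 1 ≤ m := by omega
    constructor
    · rw [← encard_sides hm1, ← encard_image_sphere]
      congr 1
      ext F
      constructor
      · rintro ⟨hF, hA, hB, i, hi⟩
        obtain ⟨w, rfl⟩ : F ∈ Set.range C.face := hfaces ▸ hF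
        rcases w with k | g
        · exact absurd ⟨k, rfl⟩ hA
        · exact ⟨g, ⟨sphereB.1 hB, i, adj_sphere_side.1 (adj.1 hi)⟩, rfl⟩
      · rintro ⟨g, ⟨hc, i, hi⟩, rfl⟩
        exact ⟨hfaces ▸ ⟨_, rfl⟩, sphereA g, sphereB.2 hc, i, adj.2 (adj_sphere_side.2 hi)⟩
    · rw [← encard_interior hm1, ← encard_image_sphere]
      congr 1
      ext F
      constructor
      · rintro ⟨hF, hA, hadj⟩
        obtain ⟨w, rfl⟩ : F ∈ Set.range C.face := hfaces ▸ hF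
        rcases w with k | g
        · exact absurd ⟨k, rfl⟩ hA
        · exact ⟨g, fun i h => hadj i (adj.2 (adj_sphere_side.2 h)), rfl⟩
      · rintro ⟨g, hg, rfl⟩
        exact ⟨hfaces ▸ ⟨_, rfl⟩, sphereA g, fun i h => hg i (adj_sphere_side.1 (adj.1 h))⟩

lemma encard_faces_triPoly (m : ℕ) :
    (faces (triPoly m)).encard = (((m + 1) ^ 2 + (m + 1) + 6) / 2 : ℕ) := by
  rw [triPoly, (triCone m).faces_poly, ← Set.image_univ, (triCone m).face_injective.encard_image,
    Set.encard_univ, ENat.card_eq_coe_natCard, card_wall]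

lemma encard_idealVertices_triPoly (m : ℕ) :
    (idealVertices (triPoly m)).encard = ((m + 1) ^ 2 + (m + 1) + 2 : ℕ) := by
  rw [triPoly, (triCone m).idealVertices_poly, ← Set.image_univ,
    (triCone m).point_injective.encard_image, Set.encard_univ, ENat.card_eq_coe_natCard, card_vert]

/-- The number of faces is an isometry invariant and strictly increases with `m`. -/
lemma triPoly_class_injective :
    Function.Injective fun m => Quotient.mk congruence (triPoly m) := by
  intro m m' h
  have h1 : Congruent (triPoly m) (triPoly m') := Quotient.exact h
  have h2 := h1.encard_faces_eq
  rw [encard_faces_triPoly, encard_faces_triPoly, ← card_wall, ← card_wall, Nat.card_sum,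
    Nat.card_sum, Nat.cast_inj, Nat.add_left_cancel_iff] at h2
  have a := card_tri m
  have b := card_tri m'
  rw [h2, b] at a
  by_contra hne
  rcases Nat.lt_or_gt_of_ne hne with h | h <;> nlinarith

end

end Hyp

theorem mainTheorem2 :
    (∀ n : ℕ, 1 ≤ n → ∃ P : Set Hyp.H3,
      Hyp.IsIdealPolyhedron P ∧ Hyp.IsEquiangular (Real.pi / 3) P ∧
      Hyp.HasStructure n P ∧
      (Hyp.faces P).encard = ((n ^ 2 + n + 6) / 2 : ℕ) ∧
      (Hyp.idealVertices P).encard = (n ^ 2 + n + 2 : ℕ)) ∧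
    {c : Quotient Hyp.congruence | ∃ P : Set Hyp.H3,
      Hyp.IsEquiangular (Real.pi / 3) P ∧ Quotient.mk Hyp.congruence P = c}.Infinite := by
  constructor
  · intro n hn
    obtain ⟨m, rfl⟩ := Nat.exists_eq_add_of_le' hn
    exact ⟨Hyp.triPoly m, (Hyp.triCone m).isIdealPolyhedron, (Hyp.triCone m).isEquiangular,
      Hyp.hasStructure m, Hyp.encard_faces_triPoly m, Hyp.encard_idealVertices_triPoly m⟩
  · refine (Set.infinite_range_of_injective Hyp.triPoly_class_injective).mono ?_
    rintro _ ⟨m, rfl⟩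
    exact ⟨Hyp.triPoly m, (Hyp.triCone m).isEquiangular, rfl⟩
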